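/- Let $d\ge 1$, $T>0$, $\Omega=2\pi/T$, $\mathbb T=\mathbb R/T\mathbb Z$ with normalized Lebesgue measure, and $e_n(t)=e^{in\Omega t}$. Equip $\mathbb C^{d\times d}$ with the trace norm $\|a\|_1=\operatorname{tr}\sqrt{a^\dagger a}$. Let $\iota:\mathbb C^{d\times d}\,\bar\otimes\,L^2(\mathbb T)\to\mathscr L^2(\mathbb T,\mathbb C^{d\times d})$ be the isometric isomorphism with $\iota(a\otimes h)(t)=h(t)a$, where the norm on the tensor space is the one carried over from $\mathscr L^2$. For an operator $A$ on $\mathscr L^2(\mathbb T,\mathbb C^{d\times d})$ with domain $D(A)$ let $\tilde A=\iota^{-1}A\iota$, with domain $\iota^{-1}(D(A))$. A bounded operator-valued function $t\mapsto A_t$ on $\mathbb T$ induces the operator $(Af)(t)=A_t(f(t))$. Let $F_n e_m=e_{m+n}$, and let $F_z$ be the self-adjoint operator on $L^2(\mathbb T)$ with $F_ze_n=ne_n$; the operator $I\otimes F_z$ is taken with domain $\iota^{-1}(C^1(\mathbb T,\mathbb C^{d\times d}))$. Let $t\mapsto H_t=H_t^\dagger\in\mathbb C^{d\times d}$ be continuous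 and $T$-periodic, let $u_t$ solve $\dot u_t=-iH_tu_t$, $u_0=I$, let $\bar H=\bar H^\dagger$ satisfy $e^{-iT\bar H}=u_T$, and put $p_t=u_te^{it\bar H}$, so that $p_t$ is unitary and $T$-periodic and $u_t=p_te^{-it\bar H}$. Put $P_t(a)=p_tap_t^\dagger$ and $P'_t(a)=p_t^\dagger ap_t=P_t^{-1}(a)$, which is the dual of $P_t$ for the pairing $(a,b)=\operatorname{tr}(ab)$. Let $$K(a)=\sum_{k,k'}\sum_{q\in\mathbb Z}\sum_{\omega}\gamma_{kk'}(\omega+q\Omega)\Big(S_{kq\omega}\,a\,S_{k'q\omega}^\dagger-\tfrac12\{S_{k'q\omega}^\dagger S_{kq\omega},a\}\Big),$$ where $k,k'$ range over a finite set, $\omega$ over the Bohr quasifrequencies $\{\epsilon-\epsilon':\epsilon,\epsilon'\in\operatorname{spec}\bar H\}$, the matrices $[\gamma_{kk'}(\omega+q\Omega)]_{k,k'}$ are positive semidefinite, and $S_{kq\omega}\in\mathbb C^{d\times d}$ are matrices for which the series over $q$ converges for each $k,k'$. (This covers the matrices of the weak coupling limit, which in addition satisfy $[\bar H,S_{kq\omega}]=\omega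 S_{kq\omega}$ and $S_{kq\omega}^\dagger=S_{k,-q,-\omega}$.) Put $$L_t=-i[H_t,\cdot\,]+P_tKP_t^{-1},\qquad \bar L=-i[\bar H,\cdot\,]+K,\qquad L_n=\frac1T\int_0^TL_te^{-in\Omega t}\,dt,$$ and let $\mathcal L=L-\frac{d}{dt}$ with domain $C^1(\mathbb T,\mathbb C^{d\times d})$ be the generalized Lindbladian. Then the following hold. 1. $\tilde L=\sum_{n\in\mathbb Z}L_n\otimes F_n$, where the series applied to $x$ converges (unconditionally, in the norm of $\mathbb C^{d\times d}\,\bar\otimes\,L^2(\mathbb T)$) to $\tilde Lx$ for every $x\in\iota^{-1}(C^0(\mathbb T,\mathbb C^{d\times d}))$. 2. As unbounded operators, with equality of domains, $$\tilde{\mathcal L}=\tilde L-i\Omega\,I\otimes F_z=\tilde P\,(\bar L\otimes I-i\Omega\,I\otimes F_z)\,\tilde P'.$$ 3. $\tilde L$ is of standard (GKLS) form: there are essentially bounded functions $h=h^*$ and $v_1,\dots,v_{d^2-1}$ on $\mathbb T$ with values in $\mathbb C^{d\times d}$ such that for all $x\in\mathbb C^{d\times d}\,\bar\otimes\,L^2(\mathbb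 T)$ $$\tilde L x=-i[\tilde h,x]+\sum_{k=1}^{d^2-1}\Big(\tilde v_k\,x\,\tilde v_k^*-\tfrac12\{\tilde v_k^*\tilde v_k,x\}\Big),$$ where $\tilde h=\iota^{-1}(h)$, $\tilde v_k=\iota^{-1}(v_k)$, and products and adjoints in the tensor space are the pointwise ones, $\tilde f\tilde g=\iota^{-1}(fg)$ and $\tilde f^*=\iota^{-1}(f^*)$ with $f^*(t)=f(t)^\dagger$. -/

import Mathlib

open MeasureTheory
open scoped Matrix ENNReal Topology TensorProduct ComplexOrder

noncomputable section

namespace FloquetLindblad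

variable {d : ℕ}

/-- The space `ℂ^{d×d}` of complex square matrices of size `d`. -/
abbrev Mat (d : ℕ) : Type := Matrix (Fin d) (Fin d) ℂ

namespace Propagator

open Complex

section

open scoped Matrix.Norms.L2Operator

variable {H u : ℝ → Mat d}

lemma hasDerivAt_star_mul (hH : ∀ t, (H t).IsHermitian) {v w : ℝ → Mat d} {t : ℝ}
    (hv : HasDerivAt v (-(I • (H t * v t))) t) (hw : HasDerivAt w (-(I • (H t * w t))) t) :
    HasDerivAt (fun s => (v s)ᴴ * w s) 0 t := by
  have h := (HasDerivAt.star hv).mul hw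
  have h0 : star (-(I • (H t * v t))) * w t + star (v t) * (-(I • (H t * w t))) = 0 := by
    have : (H t)ᴴ = H t := hH t
    simp [Matrix.star_eq_conjTranspose, this, mul_assoc]
  rw [h0] at h
  exact h

lemma const_of_deriv_zero {f : ℝ → Mat d} (h : ∀ t, HasDerivAt f 0 t) (t : ℝ) : f t = f 0 :=
  is_const_of_deriv_eq_zero (fun t => (h t).differentiableAt) (fun t => (h t).deriv) t 0

/-- The propagator of a self-adjoint Hamiltonian is unitary. -/
lemma star_mul_self (hH : ∀ t, (H t).IsHermitian) (h0 : u 0 = 1)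
    (hu : ∀ t, HasDerivAt u (-(I • (H t * u t))) t) (t : ℝ) : (u t)ᴴ * u t = 1 := by
  rw [const_of_deriv_zero (f := fun s => (u s)ᴴ * u s)
    (fun t => hasDerivAt_star_mul hH (hu t) (hu t)) t]
  simp [h0]

/-- Monodromy relation for a periodic Hamiltonian. -/
lemma add_period (hH : ∀ t, (H t).IsHermitian) {T : ℝ} (hT : Function.Periodic H T)
    (h0 : u 0 = 1) (hu : ∀ t, HasDerivAt u (-(I • (H t * u t))) t) (t : ℝ) :
    u (t + T) = u t * u T := by
  have hw : ∀ t, HasDerivAt (fun s => u (s + T)) (-(I • (H t * u (t + T)))) t := fun t => by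
    have := (hu (t + T)).comp_add_const t T
    rwa [hT t] at this
  have h1 := const_of_deriv_zero (f := fun s => (u s)ᴴ * u (s + T))
    (fun t => hasDerivAt_star_mul hH (hu t) (hw t)) t
  have h2 : (u t)ᴴ * u (t + T) = u T := by simpa [h0] using h1
  have h3 : u t * (u t)ᴴ = 1 := mul_eq_one_comm.1 (star_mul_self hH h0 hu t)
  rw [← h2, ← mul_assoc, h3, one_mul]

lemma continuous_of_hasDerivAt {f f' : ℝ → Mat d} (h : ∀ t, HasDerivAt f (f' t) t) :
    Continuous f :=
  continuous_iff_continuousAt.2 fun t => (h t).continuousAt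

lemma continuous_exp (A : Mat d) : Continuous fun t : ℝ => NormedSpace.exp (((t : ℂ) * I) • A) :=
  letI : NormedAlgebra ℚ (Mat d) := NormedAlgebra.restrictScalars ℚ ℂ (Mat d)
  (NormedSpace.exp_continuous (𝔸 := Mat d)).comp (by fun_prop)

end

lemma exp_star_mul_exp {A : Mat d} (hA : A.IsHermitian) (t : ℝ) :
    (NormedSpace.exp (((t : ℂ) * I) • A))ᴴ * NormedSpace.exp (((t : ℂ) * I) • A) = 1 := by
  have hA' : Aᴴ = A := hA
  rw [← Matrix.exp_conjTranspose, Matrix.conjTranspose_smul, hA',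
    ← Matrix.exp_add_of_commute _ _ ((Commute.refl A).smul_left _ |>.smul_right _), ← add_smul]
  simp

end Propagator

namespace TraceNorm

/-- The trace norm `‖a‖₁ = tr √(a† a)`. -/
def traceNorm (a : Mat d) : ℝ := (Matrix.trace (cfc Real.sqrt (aᴴ * a))).re

/-- The eigenvalues of `a† a`. -/
def sq (a : Mat d) : Fin d → ℝ := (Matrix.isHermitian_conjTranspose_mul_self a).eigenvalues

lemma sq_nonneg (a : Mat d) (i : Fin d) : 0 ≤ sq a i :=
  (Matrix.posSemidef_conjTranspose_mul_self a).eigenvalues_nonneg i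

lemma traceNorm_eq_sum (a : Mat d) : traceNorm a = ∑ i, √(sq a i) := by
  have h := Matrix.isHermitian_conjTranspose_mul_self a
  rw [traceNorm, h.cfc_eq, Matrix.IsHermitian.cfc, Unitary.conjStarAlgAut_apply,
    Matrix.trace_mul_comm, ← mul_assoc]
  simp [Matrix.trace, sq]

/-- The unitary matrix of eigenvectors of `a† a`. -/
def evec (a : Mat d) : Mat d := (Matrix.isHermitian_conjTranspose_mul_self a).eigenvectorUnitary

lemma evec_star_mul (a : Mat d) : (evec a)ᴴ * evec a = 1 := by
  have := (Matrix.mem_unitaryGroup_iff'.1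
    (Matrix.isHermitian_conjTranspose_mul_self a).eigenvectorUnitary.2)
  simpa [evec, Matrix.star_eq_conjTranspose] using this

lemma evec_mul_star (a : Mat d) : evec a * (evec a)ᴴ = 1 :=
  mul_eq_one_comm.1 (evec_star_mul a)

lemma diagonalize (a : Mat d) :
    (a * evec a)ᴴ * (a * evec a) = Matrix.diagonal fun i => (sq a i : ℂ) := by
  have h := (Matrix.isHermitian_conjTranspose_mul_self a).spectral_theorem
  rw [Unitary.conjStarAlgAut_apply] at h
  have h' : aᴴ * a = evec a * (Matrix.diagonal fun i => (sq a i : ℂ)) * (evec a)ᴴ := h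
  calc (a * evec a)ᴴ * (a * evec a) = (evec a)ᴴ * (aᴴ * a) * evec a := by
        rw [Matrix.conjTranspose_mul]; simp only [mul_assoc]
    _ = ((evec a)ᴴ * evec a) * (Matrix.diagonal fun i => (sq a i : ℂ)) *
          ((evec a)ᴴ * evec a) := by rw [h']; simp only [mul_assoc]
    _ = _ := by rw [evec_star_mul]; simp

open scoped Matrix.Norms.L2Operator in
lemma norm_evec_le (a : Mat d) : ‖evec a‖ ≤ 1 := by
  have h1 : ‖(evec a)ᴴ * evec a‖ = ‖evec a‖ * ‖evec a‖ := Matrix.l2_opNorm_conjTranspose_mul_self _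
  rw [evec_star_mul] at h1
  have h2 : ‖(1 : Mat d)‖ ≤ 1 := by
    rw [← Matrix.diagonal_one, Matrix.l2_opNorm_diagonal, pi_norm_le_iff_of_nonneg zero_le_one]
    intro i; simp
  nlinarith [norm_nonneg (evec a)]

/-- A contraction that realizes the trace norm. -/
def polar (a : Mat d) : Mat d :=
  evec a * (Matrix.diagonal fun i => (((√(sq a i))⁻¹ : ℝ) : ℂ)) * (a * evec a)ᴴ

lemma trace_polar_mul (a : Mat d) : Matrix.trace (polar a * a) = (traceNorm a : ℂ) := by
  have : polar a * a = evec a * ((Matrix.diagonal fun i => (((√(sq a i))⁻¹ : ℝ) : ℂ)) *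
      ((a * evec a)ᴴ * a)) := by simp only [polar, mul_assoc]
  rw [this, Matrix.trace_mul_comm, mul_assoc, mul_assoc, diagonalize, Matrix.diagonal_mul_diagonal,
    Matrix.trace_diagonal, traceNorm_eq_sum, Complex.ofReal_sum]
  refine Finset.sum_congr rfl fun i _ => ?_
  rw [← Complex.ofReal_mul]
  congr 1
  have h0 := sq_nonneg a i
  rcases h0.eq_or_lt with h | h
  · simp [← h]
  · have := Real.sqrt_pos.2 h
    field_simp
    exact (Real.sq_sqrt h0).symm

open scoped Matrix.Norms.L2Operator in
lemma norm_polar_le (a : Mat d) : ‖polar a‖ ≤ 1 := by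
  set R : Mat d := Matrix.diagonal fun i => (((√(sq a i))⁻¹ : ℝ) : ℂ) with hR
  have hRs : Rᴴ = R := by
    rw [hR, Matrix.diagonal_conjTranspose]; congr 1; ext i; simp
  set c : Mat d := R * (a * evec a)ᴴ with hc
  have hp : polar a = evec a * c := by rw [polar, hc, mul_assoc]
  have hcc : c * cᴴ = Matrix.diagonal
      fun i => (((√(sq a i))⁻¹ * (sq a i) * (√(sq a i))⁻¹ : ℝ) : ℂ) := by
    have hcs : cᴴ = a * evec a * R := by
      rw [hc, Matrix.conjTranspose_mul, Matrix.conjTranspose_conjTranspose, hRs]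
    rw [hcs, hc]
    calc R * (a * evec a)ᴴ * (a * evec a * R)
        = R * ((a * evec a)ᴴ * (a * evec a)) * R := by simp only [mul_assoc]
      _ = _ := by
        rw [diagonalize, hR, Matrix.diagonal_mul_diagonal, Matrix.diagonal_mul_diagonal]
        congr 1; ext i; push_cast; ring
  have h1 : ‖c‖ * ‖c‖ ≤ 1 := by
    have := Matrix.l2_opNorm_conjTranspose_mul_self cᴴ
    rw [Matrix.conjTranspose_conjTranspose, Matrix.l2_opNorm_conjTranspose] at this
    rw [← this, hcc, Matrix.l2_opNorm_diagonal, pi_norm_le_iff_of_nonneg zero_le_one]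
    intro i
    have h0 := sq_nonneg a i
    rw [Complex.norm_real, Real.norm_eq_abs]
    rcases h0.eq_or_lt with h | h
    · simp [← h]
    · have hs := Real.sqrt_pos.2 h
      have : (√(sq a i))⁻¹ * (sq a i) * (√(sq a i))⁻¹ = 1 := by
        field_simp
        exact (Real.sq_sqrt h0).symm
      rw [this]; simp
  have h2 := norm_evec_le a
  have h3 : ‖c‖ ≤ 1 := by nlinarith [norm_nonneg c]
  calc ‖polar a‖ ≤ ‖evec a‖ * ‖c‖ := by rw [hp]; exact Matrix.l2_opNorm_mul _ _
    _ ≤ 1 * 1 := mul_le_mul h2 h3 (norm_nonneg _) zero_le_one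
    _ = 1 := one_mul 1

open scoped Matrix.Norms.L2Operator in
lemma norm_apply_le_of_col (w b : Mat d) (hw : ‖w‖ ≤ 1) (s : ℝ) (i : Fin d)
    (hb : (bᴴ * b) i i = (s : ℂ)) : ‖(w * b) i i‖ ≤ √s := by
  set v : EuclideanSpace ℂ (Fin d) := WithLp.toLp 2 (fun k => b k i) with hv
  have hvn : ‖v‖ = √s := by
    rw [EuclideanSpace.norm_eq]
    congr 1
    have : (bᴴ * b) i i = ((∑ k, ‖b k i‖ ^ 2 : ℝ) : ℂ) := by
      rw [Matrix.mul_apply, Complex.ofReal_sum]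
      refine Finset.sum_congr rfl fun k _ => ?_
      rw [Matrix.conjTranspose_apply, Complex.star_def, Complex.conj_mul']
      push_cast; rfl
    rw [this] at hb
    exact_mod_cast hb
  have h1 := Matrix.l2_opNorm_mulVec w v
  have h2 : (w * b) i i = ((EuclideanSpace.equiv (Fin d) ℂ).symm <| w *ᵥ v) i := rfl
  rw [h2]
  refine (PiLp.norm_apply_le _ i).trans (h1.trans ?_)
  rw [hvn]
  nlinarith [Real.sqrt_nonneg s]

open scoped Matrix.Norms.L2Operator in
lemma norm_trace_mul_le (w a : Mat d) (hw : ‖w‖ ≤ 1) :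
    ‖Matrix.trace (w * a)‖ ≤ traceNorm a := by
  have h : Matrix.trace (w * a) = Matrix.trace (((evec a)ᴴ * w) * (a * evec a)) := by
    rw [mul_assoc (evec a)ᴴ, Matrix.trace_mul_comm (evec a)ᴴ, mul_assoc w, mul_assoc a, evec_mul_star, mul_one]
  have hw' : ‖(evec a)ᴴ * w‖ ≤ 1 := by
    refine (Matrix.l2_opNorm_mul _ _).trans ?_
    rw [Matrix.l2_opNorm_conjTranspose]
    calc _ ≤ 1 * 1 := mul_le_mul (norm_evec_le a) hw (norm_nonneg _) zero_le_one
      _ = 1 := one_mul 1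
  rw [h, traceNorm_eq_sum, Matrix.trace]
  refine (norm_sum_le _ _).trans (Finset.sum_le_sum fun i _ => ?_)
  exact norm_apply_le_of_col _ _ hw' _ i (by rw [diagonalize]; simp)

lemma traceNorm_nonneg (a : Mat d) : 0 ≤ traceNorm a := by
  rw [traceNorm_eq_sum]; positivity

lemma traceNorm_add_le (a b : Mat d) : traceNorm (a + b) ≤ traceNorm a + traceNorm b := by
  have h := trace_polar_mul (a + b)
  rw [mul_add, Matrix.trace_add] at h
  have h' : ‖(traceNorm (a + b) : ℂ)‖ = traceNorm (a + b) := by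
    rw [Complex.norm_real, Real.norm_of_nonneg (traceNorm_nonneg _)]
  rw [← h', ← h]
  exact (norm_add_le _ _).trans (add_le_add (norm_trace_mul_le _ _ (norm_polar_le _))
    (norm_trace_mul_le _ _ (norm_polar_le _)))

lemma traceNorm_smul_le (c : ℂ) (a : Mat d) : traceNorm (c • a) ≤ ‖c‖ * traceNorm a := by
  have h := trace_polar_mul (c • a)
  have h' : ‖(traceNorm (c • a) : ℂ)‖ = traceNorm (c • a) := by
    rw [Complex.norm_real, Real.norm_of_nonneg (traceNorm_nonneg _)]
  rw [← h', ← h, Matrix.mul_smul, Matrix.trace_smul, smul_eq_mul, norm_mul]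
  gcongr
  exact norm_trace_mul_le _ _ (norm_polar_le _)

lemma traceNorm_smul (c : ℂ) (a : Mat d) : traceNorm (c • a) = ‖c‖ * traceNorm a := by
  refine le_antisymm (traceNorm_smul_le c a) ?_
  rcases eq_or_ne c 0 with rfl | hc
  · simpa using traceNorm_nonneg _
  · have h := traceNorm_smul_le c⁻¹ (c • a)
    rw [smul_smul, inv_mul_cancel₀ hc, one_smul, norm_inv] at h
    have hc' : 0 < ‖c‖ := norm_pos_iff.2 hc
    calc ‖c‖ * traceNorm a ≤ ‖c‖ * (‖c‖⁻¹ * traceNorm (c • a)) := by gcongr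
      _ = _ := by field_simp

lemma traceNorm_eq_zero_iff (a : Mat d) : traceNorm a = 0 ↔ a = 0 := by
  constructor
  · intro h
    rw [traceNorm_eq_sum, Finset.sum_eq_zero_iff_of_nonneg (fun i _ => Real.sqrt_nonneg _)] at h
    have h0 : (Matrix.diagonal fun i => (sq a i : ℂ)) = (0 : Mat d) := by
      rw [Matrix.diagonal_eq_zero]
      ext i
      have := (Real.sqrt_eq_zero (sq_nonneg a i)).1 (h i (Finset.mem_univ i))
      simp [this]
    have h1 := diagonalize a
    rw [h0, Matrix.conjTranspose_mul_self_eq_zero] at h1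
    calc a = (a * evec a) * (evec a)ᴴ := by rw [mul_assoc, evec_mul_star, mul_one]
      _ = 0 := by rw [h1, zero_mul]
  · rintro rfl
    simp [traceNorm]

/-- The trace norm, as the norm of the space of matrices. -/
abbrev normInst (d : ℕ) : Norm (Mat d) := ⟨traceNorm⟩

attribute [local instance] normInst

lemma normCore : NormedSpace.Core ℂ (Mat d) where
  norm_nonneg := traceNorm_nonneg
  norm_smul := traceNorm_smul
  norm_triangle := traceNorm_add_le
  norm_eq_zero_iff := traceNorm_eq_zero_iff

/-- An auxiliary copy of the space of matrices, with the topology of the trace norm. -/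
def Aux (d : ℕ) : Type := Mat d

instance : AddCommGroup (Aux d) := inferInstanceAs (AddCommGroup (Mat d))
instance : Module ℂ (Aux d) := inferInstanceAs (Module ℂ (Mat d))
instance : FiniteDimensional ℂ (Aux d) := inferInstanceAs (FiniteDimensional ℂ (Mat d))
instance : Norm (Aux d) := inferInstanceAs (Norm (Mat d))

lemma auxCore : NormedSpace.Core ℂ (Aux d) := normCore (d := d)

instance : NormedAddCommGroup (Aux d) := NormedAddCommGroup.ofCore auxCore
instance : NormedSpace ℂ (Aux d) := NormedSpace.ofCore auxCore

lemma uniformity_eq : uniformity (Mat d) =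
    @uniformity _ (PseudoEMetricSpace.toUniformSpace
      (self := PseudoEMetricSpace.ofSeminormedSpaceCore (normCore (d := d)).toCore)) := by
  let e : Mat d ≃ₗ[ℂ] Aux d := LinearEquiv.refl ℂ (Mat d)
  have h1 := e.toContinuousLinearEquiv.toHomeomorph.isInducing.eq_induced
  have h2 := h1.trans (induced_id (t := (PseudoEMetricSpace.toUniformSpace
      (self := PseudoEMetricSpace.ofSeminormedSpaceCore
        (normCore (d := d)).toCore)).toTopologicalSpace))
  have key : Matrix.instUniformSpace (Fin d) (Fin d) ℂ = PseudoEMetricSpace.toUniformSpace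
      (self := PseudoEMetricSpace.ofSeminormedSpaceCore (normCore (d := d)).toCore) :=
    IsUniformAddGroup.ext (inferInstance : IsUniformAddGroup (Mat d))
      (inferInstance : IsUniformAddGroup (Aux d)) (congrArg (fun t => @nhds _ t 0) h2)
  exact congrArg (fun u => @uniformity _ u) key

end TraceNorm

/-- `ℂ^{d×d}` with the trace norm. The topology is the usual one. -/
instance instNormedAddCommGroupMat : NormedAddCommGroup (Mat d) :=
  letI := TraceNorm.normInst d
  NormedAddCommGroup.ofCoreReplaceUniformity TraceNorm.normCore TraceNorm.uniformity_eq

instance instNormedSpaceMat : NormedSpace ℂ (Mat d) := NormedSpace.ofCore TraceNorm.normCore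

lemma norm_mat_def (a : Mat d) : ‖a‖ = (Matrix.trace (cfc Real.sqrt (aᴴ * a))).re := rfl

/-! ### Maps of matrices -/

/-- The map `a ↦ x a y` on matrices. -/
def mulLR (x y : Mat d) : Mat d →L[ℂ] Mat d :=
  LinearMap.toContinuousLinearMap (LinearMap.mulLeft ℂ x ∘ₗ LinearMap.mulRight ℂ y)

@[simp] lemma mulLR_apply (x y a : Mat d) : mulLR x y a = x * (a * y) := rfl

/-- The commutator map `a ↦ [x, a]`. -/
def adMap (x : Mat d) : Mat d →L[ℂ] Mat d := mulLR x 1 - mulLR 1 x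

/-- The map `a ↦ x a y† - ½ {y† x, a}`. -/
def dissipator (x y : Mat d) : Mat d →L[ℂ] Mat d :=
  mulLR x yᴴ - (1 / 2 : ℂ) • (mulLR (yᴴ * x) 1 + mulLR 1 (yᴴ * x))

/-- The dual `U'` of a map `U` on matrices for the pairing `(a, b) = tr (a b)`. -/
def dualMap (U : Mat d →L[ℂ] Mat d) : Mat d →L[ℂ] Mat d :=
  LinearMap.toContinuousLinearMap
    { toFun := fun a => Matrix.of fun i j => Matrix.trace (a * U (Matrix.single j i 1))
      map_add' := fun a b => by ext i j; simp [add_mul]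
      map_smul' := fun c a => by ext i j; simp }

lemma dualMap_apply (U : Mat d →L[ℂ] Mat d) (a : Mat d) (i j : Fin d) :
    dualMap U a i j = Matrix.trace (a * U (Matrix.single j i 1)) := rfl

lemma trace_dualMap_mul (U : Mat d →L[ℂ] Mat d) (a b : Mat d) :
    Matrix.trace (dualMap U a * b) = Matrix.trace (a * U b) := by
  conv_rhs => rw [Matrix.matrix_eq_sum_single b]
  have h : ∀ i j, Matrix.single i j (b i j) = b i j • (Matrix.single i j 1 : Mat d) := by
    intro i j; simp
  simp only [h, map_sum, map_smul, Finset.mul_sum, Matrix.trace_sum, Matrix.mul_smul,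
    Matrix.trace_smul, smul_eq_mul]
  rw [Matrix.trace, Finset.sum_comm]
  simp only [Matrix.diag_apply, Matrix.mul_apply]
  refine Finset.sum_congr rfl fun j _ => Finset.sum_congr rfl fun i _ => ?_
  rw [dualMap_apply, mul_comm]

/-! ### Unbounded operators -/

/-- The composition `U A V` on its natural domain, for an unbounded operator `A` and everywhere
defined operators `U` and `V`. -/
def sandwich {E F G : Type*} [AddCommGroup E] [Module ℂ E] [AddCommGroup F] [Module ℂ F]
    [AddCommGroup G] [Module ℂ G] (U : F →ₗ[ℂ] G) (A : F →ₗ.[ℂ] F) (V : E →ₗ[ℂ] F) :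
    E →ₗ.[ℂ] G where
  domain := A.domain.comap V
  toFun := U ∘ₗ A.toFun ∘ₗ V.restrict (fun _ hx => hx)

/-- The unbounded operator `j v ↦ g v`, defined on the range of an injective linear map `j`. -/
def pmapOfInjective {V E F : Type*} [AddCommGroup V] [Module ℂ V] [AddCommGroup E] [Module ℂ E]
    [AddCommGroup F] [Module ℂ F] (j : V →ₗ[ℂ] E) (hj : Function.Injective j) (g : V →ₗ[ℂ] F) :
    E →ₗ.[ℂ] F where
  domain := LinearMap.range j
  toFun := g ∘ₗ (LinearEquiv.ofInjective j hj).symm.toLinearMap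

lemma pmapOfInjective_apply {V E F : Type*} [AddCommGroup V] [Module ℂ V] [AddCommGroup E]
    [Module ℂ E] [AddCommGroup F] [Module ℂ F] (j : V →ₗ[ℂ] E) (hj : Function.Injective j)
    (g : V →ₗ[ℂ] F) (v : V) : pmapOfInjective j hj g ⟨j v, v, rfl⟩ = g v := by
  have : (LinearEquiv.ofInjective j hj).symm ⟨j v, v, rfl⟩ = v := by
    rw [LinearEquiv.symm_apply_eq]; rfl
  exact congrArg g this

/-! ### Functions on the circle -/

open AddCircle

/-- A continuous `T`-periodic function, as a continuous function on `ℝ / Tℤ`. -/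
def circleLift {X : Type*} [TopologicalSpace X] {T : ℝ} (f : ℝ → X) (hf : Function.Periodic f T)
    (hc : Continuous f) : C(AddCircle T, X) where
  toFun := hf.lift
  continuous_toFun := continuous_coinduced_dom.2 hc

@[simp] lemma circleLift_coe {X : Type*} [TopologicalSpace X] {T : ℝ} (f : ℝ → X)
    (hf : Function.Periodic f T) (hc : Continuous f) (t : ℝ) :
    circleLift f hf hc (t : AddCircle T) = f t := rfl

section Circle

variable (d) (T : ℝ) [hT : Fact (0 < T)]

/-- `L²(𝕋)`, for the normalized Lebesgue measure of the circle. -/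
abbrev L2Circle : Type := Lp ℂ 2 (haarAddCircle (T := T))

/-- The generalized space of states `𝓛²(𝕋, ℂ^{d×d})`. -/
abbrev FloquetSpace : Type := Lp (Mat d) 2 (haarAddCircle (T := T))

variable {d T}

/-- The operator `(A f)(t) = A_t (f t)` of an essentially bounded operator-valued function. -/
def pointwiseOp (A : Lp (Mat d →L[ℂ] Mat d) ∞ (haarAddCircle (T := T))) :
    FloquetSpace d T →L[ℂ] FloquetSpace d T :=
  (ContinuousLinearMap.id ℂ (Mat d →L[ℂ] Mat d)).holderL haarAddCircle ∞ 2 2 A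

/-- The operator `(A f)(t) = A_t (f t)` of a continuous operator-valued function. -/
def continuousOp (A : C(AddCircle T, Mat d →L[ℂ] Mat d)) :
    FloquetSpace d T →L[ℂ] FloquetSpace d T :=
  pointwiseOp (ContinuousMap.toLp ∞ haarAddCircle ℂ A)

lemma continuousOp_ae (A : C(AddCircle T, Mat d →L[ℂ] Mat d)) (f : FloquetSpace d T) :
    continuousOp A f =ᵐ[haarAddCircle] fun t => A t (f t) := by
  have h1 := ContinuousLinearMap.coeFn_holder (r := 2) (ContinuousLinearMap.id ℂ (Mat d →L[ℂ] Mat d))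
    (ContinuousMap.toLp (E := Mat d →L[ℂ] Mat d) ∞ haarAddCircle ℂ A) f
  have h2 := ContinuousMap.coeFn_toLp (p := ∞) (𝕜 := ℂ) haarAddCircle A
  filter_upwards [h1, h2] with t h1 h2
  exact h1.trans (by rw [h2]; rfl)

/-! ### The tensor form of the generalized space of states -/

/-- The elementary function `(a ⊙ h)(t) = h(t) a`. -/
def odot (a : Mat d) (h : L2Circle T) : FloquetSpace d T :=
  (ContinuousLinearMap.toSpanSingleton ℂ a).compLp h

lemma odot_ae (a : Mat d) (h : L2Circle T) :
    odot a h =ᵐ[haarAddCircle] fun t => h t • a := by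
  filter_upwards [ContinuousLinearMap.coeFn_compLp (ContinuousLinearMap.toSpanSingleton ℂ a) h]
    with t ht
  exact ht

/-- The embedding `ι` of the tensor product, `ι (a ⊗ h) = a ⊙ h`. -/
def iotaMap : Mat d ⊗[ℂ] L2Circle T →ₗ[ℂ] FloquetSpace d T :=
  TensorProduct.lift (LinearMap.mk₂ ℂ odot
    (fun a b h => by
      rw [odot, ContinuousLinearMap.toSpanSingleton_add, ContinuousLinearMap.add_compLp]; rfl)
    (fun c a h => by
      rw [odot, ContinuousLinearMap.toSpanSingleton_smul, ContinuousLinearMap.smul_compLp]; rfl)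
    (fun a h k => map_add ((ContinuousLinearMap.toSpanSingleton ℂ a).compLpL 2 haarAddCircle) h k)
    (fun c a h =>
      map_smul ((ContinuousLinearMap.toSpanSingleton ℂ a).compLpL 2 haarAddCircle) c h))

@[simp] lemma iotaMap_tmul (a : Mat d) (h : L2Circle T) :
    iotaMap (a ⊗ₜ[ℂ] h) = odot a h := rfl

/-- The matrix entry `a ↦ a i j`. -/
def entry (i j : Fin d) : Mat d →L[ℂ] ℂ :=
  LinearMap.toContinuousLinearMap (Matrix.entryLinearMap ℂ ℂ i j)

@[simp] lemma entry_apply (i j : Fin d) (a : Mat d) : entry i j a = a i j := rfl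

/-- The decomposition of a matrix-valued function into matrix units. -/
def iotaInv : FloquetSpace d T →ₗ[ℂ] Mat d ⊗[ℂ] L2Circle T :=
  ∑ i, ∑ j, (TensorProduct.mk ℂ (Mat d) (L2Circle T) (Matrix.single i j 1)) ∘ₗ
    ((entry i j).compLpL 2 haarAddCircle).toLinearMap

lemma iotaInv_apply (f : FloquetSpace d T) :
    iotaInv f = ∑ i, ∑ j, (Matrix.single i j 1 : Mat d) ⊗ₜ[ℂ] (entry i j).compLp f := by
  simp [iotaInv, LinearMap.sum_apply]
  rfl

lemma entry_odot (i j : Fin d) (a : Mat d) (h : L2Circle T) :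
    (entry i j).compLp (odot a h) = a i j • h := by
  ext1
  filter_upwards [ContinuousLinearMap.coeFn_compLp (entry i j) (odot a h), odot_ae a h,
    Lp.coeFn_smul (a i j) h] with t h1 h2 h3
  rw [h1, h2, h3]
  simp [mul_comm]

lemma iotaInv_iotaMap (x : Mat d ⊗[ℂ] L2Circle T) : iotaInv (iotaMap x) = x := by
  induction x with
  | zero => simp
  | add x y hx hy => rw [map_add, map_add, hx, hy]
  | tmul a h =>
    rw [iotaMap_tmul, iotaInv_apply]
    conv_rhs => rw [Matrix.matrix_eq_sum_single a]
    simp only [TensorProduct.sum_tmul, entry_odot]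
    refine Finset.sum_congr rfl fun i _ => Finset.sum_congr rfl fun j _ => ?_
    rw [← TensorProduct.smul_tmul]
    simp

lemma coeFn_sum (s : Finset (Fin d)) (g : Fin d → FloquetSpace d T) :
    ⇑(∑ i ∈ s, g i) =ᵐ[haarAddCircle] fun t => ∑ i ∈ s, g i t := by
  classical
  induction s using Finset.induction_on with
  | empty => exact Lp.coeFn_zero (Mat d) 2 (haarAddCircle (T := T))
  | insert a s ha ih =>
    rw [Finset.sum_insert ha]
    filter_upwards [Lp.coeFn_add (g a) (∑ i ∈ s, g i), ih] with t h1 h2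
    rw [h1, Pi.add_apply, h2, Finset.sum_insert ha]

lemma iotaMap_iotaInv (f : FloquetSpace d T) : iotaMap (iotaInv f) = f := by
  rw [iotaInv_apply]
  simp only [map_sum, iotaMap_tmul]
  ext1
  have h1 : ∀ i j, odot (Matrix.single i j 1 : Mat d) ((entry i j).compLp f) =ᵐ[haarAddCircle]
      fun t => f t i j • (Matrix.single i j 1 : Mat d) := fun i j => by
    filter_upwards [odot_ae (Matrix.single i j 1 : Mat d) ((entry i j).compLp f),
      ContinuousLinearMap.coeFn_compLp (entry i j) f] with t h1 h2
    rw [h1, h2, entry_apply]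
  have h3 := coeFn_sum Finset.univ
    fun i => ∑ j, odot (Matrix.single i j 1 : Mat d) ((entry i j).compLp f)
  have h4 := fun i => coeFn_sum Finset.univ
    fun j => odot (Matrix.single i j 1 : Mat d) ((entry i j).compLp f)
  filter_upwards [h3, ae_all_iff.2 h4, ae_all_iff.2 fun i => ae_all_iff.2 (h1 i)] with t h3 h4 h5
  rw [h3]
  simp only [h4, h5]
  conv_rhs => rw [Matrix.matrix_eq_sum_single (f t)]
  simp

variable (d T) in
/-- The tensor form `ℂ^{d×d} ⊗̄ L²(𝕋)` of the generalized space of states. As `ℂ^{d×d}` is finite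
dimensional, the algebraic tensor product is already complete for the norm `‖x‖ = ‖ι x‖`. -/
abbrev TensorSpace : Type := Mat d ⊗[ℂ] L2Circle T

instance instNormedAddCommGroupTensor : NormedAddCommGroup (TensorSpace d T) :=
  NormedAddCommGroup.induced (TensorSpace d T) (FloquetSpace d T) iotaMap
    (Function.LeftInverse.injective iotaInv_iotaMap)

instance instNormedSpaceTensor : NormedSpace ℂ (TensorSpace d T) :=
  NormedSpace.induced ℂ (TensorSpace d T) (FloquetSpace d T) iotaMap

/-- The isometric isomorphism `ι : ℂ^{d×d} ⊗̄ L²(𝕋) → 𝓛²(𝕋, ℂ^{d×d})`. -/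
def iota : TensorSpace d T ≃ₗᵢ[ℂ] FloquetSpace d T where
  toLinearEquiv := LinearEquiv.ofLinearMap iotaMap iotaInv
    (LinearMap.ext iotaMap_iotaInv) (LinearMap.ext iotaInv_iotaMap)
  norm_map' := fun _ => rfl

@[simp] lemma iota_tmul (a : Mat d) (h : L2Circle T) : iota (a ⊗ₜ[ℂ] h) = odot a h := rfl

instance instCompleteSpaceTensor : CompleteSpace (TensorSpace d T) :=
  (completeSpace_congr (e := (iota (d := d) (T := T)).toEquiv)
    (iota (d := d) (T := T)).isometry.isUniformEmbedding).2 inferInstance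

/-- The Fourier lifting `Ã = ι⁻¹ A ι` of a bounded operator. -/
def lifting (A : FloquetSpace d T →L[ℂ] FloquetSpace d T) : TensorSpace d T →L[ℂ] TensorSpace d T :=
  (iota (d := d) (T := T)).symm.toContinuousLinearEquiv.toContinuousLinearMap ∘L A ∘L
    (iota (d := d) (T := T)).toContinuousLinearEquiv.toContinuousLinearMap

lemma iota_lifting (A : FloquetSpace d T →L[ℂ] FloquetSpace d T) (x : TensorSpace d T) :
    iota (lifting A x) = A (iota x) :=
  (iota (d := d) (T := T)).apply_symm_apply _

/-- The Fourier lifting `Ã = ι⁻¹ A ι`, with domain `ι⁻¹ (D(A))`, of an unbounded operator. -/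
def pmapLifting (A : FloquetSpace d T →ₗ.[ℂ] FloquetSpace d T) :
    TensorSpace d T →ₗ.[ℂ] TensorSpace d T :=
  sandwich (iota (d := d) (T := T)).symm.toLinearEquiv.toLinearMap A
    (iota (d := d) (T := T)).toLinearEquiv.toLinearMap

/-! ### Continuous and continuously differentiable functions -/

variable (d T) in
/-- `ι⁻¹(C⁰(𝕋, ℂ^{d×d}))`. -/
def tensorC0 : Submodule ℂ (TensorSpace d T) :=
  (LinearMap.range (ContinuousMap.toLp (E := Mat d) 2 (haarAddCircle (T := T)) ℂ).toLinearMap).comap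
    (iota (d := d) (T := T)).toLinearEquiv.toLinearMap

variable (d T) in
/-- `C¹(𝕋, ℂ^{d×d})`, as a space of continuous functions. -/
def C1 : Submodule ℂ C(AddCircle T, Mat d) where
  carrier := {g | ContDiff ℝ 1 fun t : ℝ => g (t : AddCircle T)}
  zero_mem' := (contDiff_const (c := (0 : Mat d)) : ContDiff ℝ 1 fun _ : ℝ => (0 : Mat d))
  add_mem' := fun {f g} hf hg => by
    have hf' : ContDiff ℝ 1 fun t : ℝ => f (t : AddCircle T) := hf
    have hg' : ContDiff ℝ 1 fun t : ℝ => g (t : AddCircle T) := hg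
    exact hf'.add hg'
  smul_mem' := fun c f hf => by
    have hf' : ContDiff ℝ 1 fun t : ℝ => f (t : AddCircle T) := hf
    exact hf'.const_smul c

lemma contDiff_C1 (g : C1 d T) :
    ContDiff ℝ 1 fun t : ℝ => (g : C(AddCircle T, Mat d)) (t : AddCircle T) := g.2

/-- The derivative of a continuously differentiable function. -/
def derivC1Fun (g : C1 d T) : C(AddCircle T, Mat d) :=
  circleLift (deriv fun t : ℝ => (g : C(AddCircle T, Mat d)) (t : AddCircle T))
    (fun t => by
      rw [← deriv_comp_add_const]
      simp)
    ((contDiff_C1 g).continuous_deriv le_rfl)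

/-- The derivative, as a linear map on `C¹(𝕋, ℂ^{d×d})`. -/
def derivC1 : C1 d T →ₗ[ℂ] C(AddCircle T, Mat d) where
  toFun := derivC1Fun
  map_add' f g := by
    ext1 x
    induction x using QuotientAddGroup.induction_on with
    | H t =>
      exact deriv_fun_add (((contDiff_C1 f).differentiable one_ne_zero) t) (((contDiff_C1 g).differentiable one_ne_zero) t)
  map_smul' c f := by
    ext1 x
    induction x using QuotientAddGroup.induction_on with
    | H t => exact deriv_fun_const_smul c (((contDiff_C1 f).differentiable one_ne_zero) t)

lemma derivC1_coe (g : C1 d T) (t : ℝ) : derivC1 g (t : AddCircle T) =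
    deriv (fun s : ℝ => (g : C(AddCircle T, Mat d)) (s : AddCircle T)) t := rfl

variable (d T) in
/-- The class in `𝓛²` of a continuously differentiable function. -/
def C1toLp : C1 d T →ₗ[ℂ] FloquetSpace d T :=
  (ContinuousMap.toLp (E := Mat d) 2 (haarAddCircle (T := T)) ℂ).toLinearMap ∘ₗ (C1 d T).subtype

instance instIsOpenPosMeasureHaar : (haarAddCircle (T := T)).IsOpenPosMeasure := by
  unfold haarAddCircle; infer_instance

lemma C1toLp_injective : Function.Injective (C1toLp d T) :=
  (ContinuousMap.toLp_injective (𝕜 := ℂ) (p := 2) (haarAddCircle (T := T))).comp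
    Subtype.val_injective

variable (d T) in
/-- The derivative operator `∂` on `𝓛²(𝕋, ℂ^{d×d})`, with domain `C¹(𝕋, ℂ^{d×d})`. -/
def derivOp : FloquetSpace d T →ₗ.[ℂ] FloquetSpace d T :=
  pmapOfInjective (V := C1 d T) (C1toLp d T) C1toLp_injective
    ((ContinuousMap.toLp (E := Mat d) 2 (haarAddCircle (T := T)) ℂ).toLinearMap ∘ₗ derivC1)

variable (d T) in
/-- `ι⁻¹(C¹(𝕋, ℂ^{d×d}))`. -/
def tensorC1 : Submodule ℂ (TensorSpace d T) :=
  (LinearMap.range (C1toLp d T)).comap (iota (d := d) (T := T)).toLinearEquiv.toLinearMap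

/-! ### Fourier operators -/

variable (T) in
/-- The Fourier shift operator `F_n` on `L²(𝕋)`: multiplication by `e_n`. -/
def fourierShift (n : ℤ) : L2Circle T →L[ℂ] L2Circle T :=
  (ContinuousLinearMap.mul ℂ ℂ).holderL haarAddCircle ∞ 2 2 (fourierLp ∞ n)

lemma fourierShift_fourierLp (n m : ℤ) :
    fourierShift T n (fourierLp 2 m) = fourierLp 2 (m + n) := by
  ext1
  have h := ContinuousLinearMap.coeFn_holder (r := 2) (ContinuousLinearMap.mul ℂ ℂ)
    (fourierLp (T := T) ∞ n) (fourierLp (T := T) 2 m)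
  filter_upwards [h, coeFn_fourierLp (T := T) ∞ n, coeFn_fourierLp (T := T) 2 m,
    coeFn_fourierLp (T := T) 2 (m + n)] with t h1 h2 h3 h4
  rw [h4, fourier_add]
  refine h1.trans ?_
  rw [h2, h3, ContinuousLinearMap.mul_apply', mul_comm]

/-- Multiplication by `n` in `ℓ²(ℤ)`, on its maximal domain. -/
def seqNumber : lp (fun _ : ℤ => ℂ) 2 →ₗ.[ℂ] lp (fun _ : ℤ => ℂ) 2 where
  domain :=
    { carrier := {x | Memℓp (fun n : ℤ => (n : ℂ) * x n) 2}
      zero_mem' := by simpa using! (zero_memℓp (E := fun _ : ℤ => ℂ) (p := 2))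
      add_mem' := fun {x y} hx hy => by
        have := Memℓp.add hx hy
        simpa [mul_add] using! this
      smul_mem' := fun c x hx => by
        have := Memℓp.const_smul hx c
        have h : (fun n : ℤ => (n : ℂ) * (c • x) n) = c • fun n : ℤ => (n : ℂ) * x n := by
          ext n; simp [mul_left_comm]
        exact Eq.mpr (congrArg (fun f => Memℓp f 2) h) this }
  toFun :=
    { toFun := fun x => ⟨fun n : ℤ => (n : ℂ) * x.1 n, x.2⟩
      map_add' := fun x y => by ext n; exact mul_add (n : ℂ) (x.1 n) (y.1 n)
      map_smul' := fun c x => by ext n; exact mul_left_comm (n : ℂ) c (x.1 n) }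

variable (T) in
/-- The Fourier number operator `F_z`, the self-adjoint operator on `L²(𝕋)` with `F_z e_n = n e_n`. -/
def fourierNumber : L2Circle T →ₗ.[ℂ] L2Circle T :=
  sandwich (fourierBasis (T := T)).repr.symm.toLinearEquiv.toLinearMap seqNumber
    (fourierBasis (T := T)).repr.toLinearEquiv.toLinearMap

lemma mem_fourierNumber_domain (h : L2Circle T) : h ∈ (fourierNumber T).domain ↔
    Memℓp (fun n : ℤ => (n : ℂ) * fourierCoeff h n) 2 := by
  have : (fun n : ℤ => (n : ℂ) * fourierCoeff h n) =
      fun n : ℤ => (n : ℂ) * (fourierBasis (T := T)).repr h n := by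
    ext n; rw [fourierBasis_repr]
  rw [this]; rfl

lemma fourierCoeff_fourierNumber (h : (fourierNumber T).domain) (n : ℤ) :
    fourierCoeff (fourierNumber T h) n = (n : ℂ) * fourierCoeff (h : L2Circle T) n := by
  rw [← fourierBasis_repr, ← fourierBasis_repr]
  have : (fourierBasis (T := T)).repr (fourierNumber T h) =
      seqNumber ⟨(fourierBasis (T := T)).repr (h : L2Circle T), h.2⟩ :=
    (fourierBasis (T := T)).repr.apply_symm_apply _
  rw [this]; rfl

variable (d T) in
/-- The operator `I ⊗ F_z`, with domain `ℂ^{d×d} ⊗ D(F_z)`. -/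
def idTensorNumberMax : TensorSpace d T →ₗ.[ℂ] TensorSpace d T :=
  pmapOfInjective (LinearMap.lTensor (Mat d) (fourierNumber T).domain.subtype)
    (Module.Flat.lTensor_preserves_injective_linearMap _ (Submodule.injective_subtype _))
    (LinearMap.lTensor (Mat d) (fourierNumber T).toFun)

variable (d T) in
/-- The operator `I ⊗ F_z` on `ι⁻¹(C¹(𝕋, ℂ^{d×d}))`. -/
def idTensorNumber : TensorSpace d T →ₗ.[ℂ] TensorSpace d T :=
  (idTensorNumberMax d T).domRestrict (tensorC1 d T)

/-! ### Standard form -/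

/-- The product of matrices as a bounded bilinear map. -/
def mulBilin : Mat d →L[ℂ] Mat d →L[ℂ] Mat d :=
  LinearMap.toContinuousLinearMap
    ((LinearMap.toContinuousLinearMap (𝕜 := ℂ) (E := Mat d) (F' := Mat d)).toLinearMap ∘ₗ
      LinearMap.mul ℂ (Mat d))

@[simp] lemma mulBilin_apply (a b : Mat d) : mulBilin a b = a * b := rfl

/-- The product `ṽ x` in the tensor space, for an essentially bounded `v`. -/
def lmul (v : Lp (Mat d) ∞ (haarAddCircle (T := T))) : TensorSpace d T →L[ℂ] TensorSpace d T :=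
  lifting (mulBilin.holderL haarAddCircle ∞ 2 2 v)

/-- The product `x ṽ` in the tensor space, for an essentially bounded `v`. -/
def rmul (v : Lp (Mat d) ∞ (haarAddCircle (T := T))) : TensorSpace d T →L[ℂ] TensorSpace d T :=
  lifting (mulBilin.flip.holderL haarAddCircle ∞ 2 2 v)

lemma iota_lmul_ae (v : Lp (Mat d) ∞ (haarAddCircle (T := T))) (x : TensorSpace d T) :
    iota (lmul v x) =ᵐ[haarAddCircle] fun t => v t * iota x t := by
  rw [lmul, iota_lifting]
  exact ContinuousLinearMap.coeFn_holder (r := 2) mulBilin v (iota x)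

lemma iota_rmul_ae (v : Lp (Mat d) ∞ (haarAddCircle (T := T))) (x : TensorSpace d T) :
    iota (rmul v x) =ᵐ[haarAddCircle] fun t => iota x t * v t := by
  rw [rmul, iota_lifting]
  exact ContinuousLinearMap.coeFn_holder (r := 2) mulBilin.flip v (iota x)

variable (d) in
/-- The conjugate transpose, as a real linear map. -/
def conjTransposeL : Mat d →L[ℝ] Mat d :=
  LinearMap.toContinuousLinearMap
    { toFun := fun a => aᴴ
      map_add' := fun a b => Matrix.conjTranspose_add a b
      map_smul' := fun c a => by ext i j; simp }

/-- The adjoint `v*(t) = v(t)†` of an essentially bounded function. -/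
def adjoint (v : Lp (Mat d) ∞ (haarAddCircle (T := T))) : Lp (Mat d) ∞ (haarAddCircle (T := T)) :=
  (conjTransposeL d).compLp v

/-- An operator on the tensor space is of standard form if it is
`x ↦ -i [h, x] + ∑ₖ (vₖ x vₖ* - ½ {vₖ* vₖ, x})` for a self-adjoint element `h` and `d² - 1` elements
`vₖ` of the tensor space, all essentially bounded. -/
def IsStandardForm (A : TensorSpace d T →L[ℂ] TensorSpace d T) : Prop :=
  ∃ (h : Lp (Mat d) ∞ (haarAddCircle (T := T)))
    (v : Fin (d ^ 2 - 1) → Lp (Mat d) ∞ (haarAddCircle (T := T))),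
    adjoint h = h ∧ ∀ x : TensorSpace d T,
      A x = -(Complex.I • (lmul h x - rmul h x)) +
        ∑ k, (lmul (v k) (rmul (adjoint (v k)) x) -
          (1 / 2 : ℂ) • (lmul (adjoint (v k)) (lmul (v k) x) +
            rmul (v k) (rmul (adjoint (v k)) x)))

end Circle

/-! ### The periodically driven open system -/

/-- The set of Bohr quasifrequencies `{ε - ε' : ε, ε' ∈ spec A}` of a self-adjoint matrix. -/
def bohrFrequencies {A : Mat d} (hA : A.IsHermitian) : Finset ℝ :=
  Finset.univ.image fun k : Fin d × Fin d => hA.eigenvalues k.1 - hA.eigenvalues k.2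

lemma mem_bohrFrequencies {A : Mat d} (hA : A.IsHermitian) (ω : ℝ) :
    ω ∈ bohrFrequencies hA ↔ ∃ ε ∈ spectrum ℝ A, ∃ ε' ∈ spectrum ℝ A, ω = ε - ε' := by
  simp [bohrFrequencies, hA.spectrum_real_eq_range_eigenvalues, eq_comm]

/-- The `q`-th term `∑_ω γ_{kl}(ω + qΩ) (S_{kqω} a S_{lqω}† - ½ {S_{lqω}† S_{kqω}, a})` of the Davies
generator, where `Ω = 2π / T`. -/
def daviesTerm {κ : Type*} (T : ℝ) (freq : Finset ℝ) (γ : ℝ → Matrix κ κ ℂ)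
    (S : κ → ℤ → ℝ → Mat d) (k l : κ) (q : ℤ) : Mat d →L[ℂ] Mat d :=
  ∑ ω ∈ freq, γ (ω + q * (2 * Real.pi / T)) k l • dissipator (S k q ω) (S l q ω)

/-- A `d`-level open system with a continuous `T`-periodic Hamiltonian `H`, propagator `u`, averaged
Hamiltonian `Hbar` (a self-adjoint logarithm of the monodromy matrix `u T`) and a Davies type
dissipator given by the matrices `γ (ω + q Ω)` and `S k q ω`. -/
structure PeriodicSystem (d : ℕ) (T : ℝ) (κ : Type*) [Fintype κ] where
  H : ℝ → Mat d
  H_hermitian : ∀ t, (H t).IsHermitian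
  H_periodic : Function.Periodic H T
  H_continuous : Continuous H
  u : ℝ → Mat d
  u_zero : u 0 = 1
  u_deriv : ∀ t, HasDerivAt u (-(Complex.I • (H t * u t))) t
  Hbar : Mat d
  Hbar_hermitian : Hbar.IsHermitian
  monodromy : u T = NormedSpace.exp (-((T : ℂ) * Complex.I) • Hbar)
  γ : ℝ → Matrix κ κ ℂ
  S : κ → ℤ → ℝ → Mat d
  γ_posSemidef : ∀ ω ∈ bohrFrequencies Hbar_hermitian, ∀ q : ℤ,
    (γ (ω + q * (2 * Real.pi / T))).PosSemidef
  summable : ∀ k l, Summable (daviesTerm T (bohrFrequencies Hbar_hermitian) γ S k l)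

namespace PeriodicSystem

variable {T : ℝ} {κ : Type*} [Fintype κ] (X : PeriodicSystem d T κ)

/-- The periodic part `p_t = u_t e^{itH̄}` of the propagator. -/
def p (t : ℝ) : Mat d := X.u t * NormedSpace.exp (((t : ℂ) * Complex.I) • X.Hbar)

/-- The Floquet normal form `u_t = p_t e^{-itH̄}` of the propagator. -/
lemma u_eq (t : ℝ) : X.u t = X.p t * NormedSpace.exp (-((t : ℂ) * Complex.I) • X.Hbar) := by
  rw [p, mul_assoc, ← Matrix.exp_add_of_commute _ _
    ((Commute.refl X.Hbar).smul_left _ |>.smul_right _), ← add_smul]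
  simp

lemma p_zero : X.p 0 = 1 := by simp [p, X.u_zero]

lemma p_periodic : Function.Periodic X.p T := by
  intro t
  have h : ((t + T : ℝ) : ℂ) * Complex.I = (T : ℂ) * Complex.I + (t : ℂ) * Complex.I := by
    push_cast; ring
  rw [p, p, Propagator.add_period X.H_hermitian X.H_periodic X.u_zero X.u_deriv, X.monodromy, h,
    add_smul, Matrix.exp_add_of_commute _ _ ((Commute.refl X.Hbar).smul_left _ |>.smul_right _),
    mul_assoc, ← mul_assoc (NormedSpace.exp _) (NormedSpace.exp _) (NormedSpace.exp _),
    ← Matrix.exp_add_of_commute _ _ ((Commute.refl X.Hbar).smul_left _ |>.smul_right _),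
    ← add_smul]
  simp

lemma p_star_mul_self (t : ℝ) : (X.p t)ᴴ * X.p t = 1 := by
  rw [p, Matrix.conjTranspose_mul, mul_assoc, ← mul_assoc (X.u t)ᴴ,
    Propagator.star_mul_self X.H_hermitian X.u_zero X.u_deriv, one_mul,
    Propagator.exp_star_mul_exp X.Hbar_hermitian]

lemma p_mul_star_self (t : ℝ) : X.p t * (X.p t)ᴴ = 1 := mul_eq_one_comm.1 (X.p_star_mul_self t)

lemma p_continuous : Continuous X.p :=
  (Propagator.continuous_of_hasDerivAt X.u_deriv).mul (Propagator.continuous_exp X.Hbar)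

/-- The map `P_t(a) = p_t a p_t†`. -/
def P (t : ℝ) : Mat d →L[ℂ] Mat d := mulLR (X.p t) (X.p t)ᴴ

/-- The inverse map `P_t⁻¹(a) = p_t† a p_t`. -/
def Pinv (t : ℝ) : Mat d →L[ℂ] Mat d := mulLR (X.p t)ᴴ (X.p t)

lemma P_comp_Pinv (t : ℝ) : X.P t ∘L X.Pinv t = ContinuousLinearMap.id ℂ (Mat d) := by
  ext1 a
  have h := X.p_mul_star_self t
  calc X.p t * ((X.p t)ᴴ * (a * X.p t) * (X.p t)ᴴ)
      = (X.p t * (X.p t)ᴴ) * a * (X.p t * (X.p t)ᴴ) := by simp only [mul_assoc]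
    _ = a := by rw [h]; simp

lemma Pinv_comp_P (t : ℝ) : X.Pinv t ∘L X.P t = ContinuousLinearMap.id ℂ (Mat d) := by
  ext1 a
  have h := X.p_star_mul_self t
  calc (X.p t)ᴴ * (X.p t * (a * (X.p t)ᴴ) * X.p t)
      = ((X.p t)ᴴ * X.p t) * a * ((X.p t)ᴴ * X.p t) := by simp only [mul_assoc]
    _ = a := by rw [h]; simp

/-- The Davies type generator `K`. -/
def K : Mat d →L[ℂ] Mat d :=
  ∑ k, ∑ l, ∑' q : ℤ, daviesTerm T (bohrFrequencies X.Hbar_hermitian) X.γ X.S k l q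

/-- The time-dependent Lindbladian `L_t = -i [H_t, ·] + P_t K P_t⁻¹`. -/
def L (t : ℝ) : Mat d →L[ℂ] Mat d := -(Complex.I • adMap (X.H t)) + X.P t ∘L X.K ∘L X.Pinv t

/-- The generator `L̄ = -i [H̄, ·] + K`. -/
def Lbar : Mat d →L[ℂ] Mat d := -(Complex.I • adMap X.Hbar) + X.K

lemma P_periodic : Function.Periodic X.P T := fun t => by rw [P, P, X.p_periodic]

lemma L_periodic : Function.Periodic X.L T := fun t => by
  rw [L, L, X.P_periodic, X.H_periodic, Pinv, Pinv, X.p_periodic]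

lemma P_continuous : Continuous X.P := by
  have := X.p_continuous
  refine continuous_clm_apply.2 fun a => ?_
  simp only [P, mulLR_apply]
  fun_prop

lemma dualMap_P (t : ℝ) : dualMap (X.P t) = X.Pinv t := by
  ext a i j
  rw [dualMap_apply, P, Pinv, mulLR_apply, mulLR_apply, ← mul_assoc, Matrix.trace_mul_comm,
    mul_assoc, Matrix.trace_single_mul]
  simp

lemma dualMap_P_periodic : Function.Periodic (fun t => dualMap (X.P t)) T :=
  fun t => by simp only [X.P_periodic t]

lemma dualMap_P_continuous : Continuous fun t => dualMap (X.P t) := by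
  have := X.p_continuous
  simp only [dualMap_P]
  refine continuous_clm_apply.2 fun a => ?_
  simp only [Pinv, mulLR_apply]
  fun_prop

lemma L_continuous : Continuous X.L := by
  have := X.p_continuous
  have := X.H_continuous
  refine continuous_clm_apply.2 fun a => ?_
  have h : ∀ t, X.L t a = -(Complex.I • (X.H t * a - a * X.H t)) +
      X.p t * (X.K ((X.p t)ᴴ * (a * X.p t)) * (X.p t)ᴴ) := fun t => by
    simp [L, adMap, P, Pinv]
  simp only [h]
  fun_prop

/-- The function `t ↦ L_t` on the circle. -/
def Lcircle : C(AddCircle T, Mat d →L[ℂ] Mat d) := circleLift X.L X.L_periodic X.L_continuous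

/-- The function `t ↦ P_t` on the circle. -/
def Pcircle : C(AddCircle T, Mat d →L[ℂ] Mat d) := circleLift X.P X.P_periodic X.P_continuous

/-- The function `t ↦ P_t'` on the circle. -/
def Pdualcircle : C(AddCircle T, Mat d →L[ℂ] Mat d) :=
  circleLift (fun t => dualMap (X.P t)) X.dualMap_P_periodic X.dualMap_P_continuous

variable [hT : Fact (0 < T)]

/-- The operator `L̃`. -/
def Ltilde : TensorSpace d T →L[ℂ] TensorSpace d T := lifting (continuousOp X.Lcircle)

/-- The operator `P̃`. -/
def Ptilde : TensorSpace d T →L[ℂ] TensorSpace d T := lifting (continuousOp X.Pcircle)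

/-- The operator `P̃'`. -/
def Pdualtilde : TensorSpace d T →L[ℂ] TensorSpace d T := lifting (continuousOp X.Pdualcircle)

/-- The generalized Lindbladian `L - ∂`, with domain `C¹(𝕋, ℂ^{d×d})`. -/
def genLindbladian : FloquetSpace d T →ₗ.[ℂ] FloquetSpace d T :=
  (continuousOp X.Lcircle).toLinearMap.toPMap ⊤ - derivOp d T

/-- The Fourier lifting of the generalized Lindbladian. -/
def genLindbladianTilde : TensorSpace d T →ₗ.[ℂ] TensorSpace d T := pmapLifting X.genLindbladian

end PeriodicSystem

end FloquetLindblad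

end

open FloquetLindblad

/-! The three claims rest on separate ideas.

Standard form. The maps of matrices that preserve self-adjointness, annihilate the trace and are
conditionally completely positive (`IsLindbladian`) form a closed convex cone. Each term of the
series over `q`, summed over `k`, `k'` and `ω`, lies in it because the matrices `γ` are positive
semidefinite, so `K` lies in it. In `IsLindbladian.exists_standardForm`, the Choi matrix of such a
map is compressed to the complement of the vectorized identity; the compression is positive
semidefinite with a nontrivial kernel, hence a sum of `d² - 1` rank one matrices, which are the
`vₖ`. What is left has the form `G a + a G†`, and annihilation of the trace fixes the self-adjoint
part of `G`. Conjugation by the unitary `p_t` is a *-automorphism, so it carries the standard form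
of `K` to one of `P_t K P_t⁻¹`, with coefficients continuous in `t`.

Fourier series. In a basis of the finite-dimensional space of maps of matrices, `L_t` becomes
finitely many scalar functions. Their Fourier series converge in `L²`, and multiplication by a
bounded matrix function is continuous from `L²` to `𝓛²` (`hasSum_fourier_continuousOp`).

Floquet form. From `ṗ = -iHp + ipH̄` it follows that `P` intertwines `d/dt + i[H̄, ·]` with `d/dt +
i[H, ·]` (`hasDerivAt_P`), which gives `L f - f' = P (L̄ g - g')` for `g = P' f`. Integration by
parts identifies `iΩ I ⊗ F_z` with the derivative on `C¹`. The domains agree because `P` and `P'`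
both preserve `C¹`. -/

noncomputable section

namespace FloquetLindblad

variable {d : ℕ}

/-! ### Generators of Lindblad form -/

/-- The Choi matrix of a map of matrices. -/
def choi (K : Mat d →L[ℂ] Mat d) : Matrix (Fin d × Fin d) (Fin d × Fin d) ℂ :=
  Matrix.of fun p q => K (Matrix.single p.2 q.2 1) p.1 q.1

lemma choi_apply (K : Mat d →L[ℂ] Mat d) (p q : Fin d × Fin d) :
    choi K p q = K (Matrix.single p.2 q.2 1) p.1 q.1 := rfl

lemma apply_eq_sum_choi (K : Mat d →L[ℂ] Mat d) (a : Mat d) (i j : Fin d) :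
    K a i j = ∑ k, ∑ l, a k l * choi K (i, k) (j, l) := by
  have h : ∀ k l, Matrix.single k l (a k l) = a k l • (Matrix.single k l 1 : Mat d) := by
    intro k l; simp
  conv_lhs => rw [Matrix.matrix_eq_sum_single a]
  simp only [h, map_sum, map_smul, Matrix.sum_apply, Matrix.smul_apply, smul_eq_mul, choi_apply]

/-- A map of matrices that preserves self-adjointness, annihilates the trace and is conditionally
completely positive. -/
structure IsLindbladian (K : Mat d →L[ℂ] Mat d) : Prop where
  map_conjTranspose : ∀ a, K aᴴ = (K a)ᴴ
  trace_apply : ∀ a, Matrix.trace (K a) = 0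
  -- Only vectors orthogonal to the vectorized identity are tested. On these the Choi form of `a ↦ G
  -- a + a G†` vanishes, so the condition does not see the Hamiltonian and anticommutator parts.
  nonneg : ∀ z : Fin d × Fin d → ℂ, ∑ i, z (i, i) = 0 → 0 ≤ star z ⬝ᵥ choi K *ᵥ z

lemma isLindbladian_zero : IsLindbladian (0 : Mat d →L[ℂ] Mat d) where
  map_conjTranspose a := by simp
  trace_apply a := by simp
  nonneg z _ := by
    have : choi (0 : Mat d →L[ℂ] Mat d) = 0 := by ext p q; simp [choi_apply]
    simp [this]

lemma IsLindbladian.add {K K' : Mat d →L[ℂ] Mat d} (h : IsLindbladian K) (h' : IsLindbladian K') :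
    IsLindbladian (K + K') where
  map_conjTranspose a := by simp [h.map_conjTranspose, h'.map_conjTranspose]
  trace_apply a := by simp [h.trace_apply, h'.trace_apply]
  nonneg z hz := by
    have : choi (K + K') = choi K + choi K' := by ext p q; simp [choi_apply]
    rw [this, Matrix.add_mulVec, dotProduct_add]
    exact add_nonneg (h.nonneg z hz) (h'.nonneg z hz)

lemma isLindbladian_sum {ι : Type*} (s : Finset ι) {K : ι → Mat d →L[ℂ] Mat d}
    (h : ∀ i ∈ s, IsLindbladian (K i)) : IsLindbladian (∑ i ∈ s, K i) :=
  Finset.sum_induction K IsLindbladian (fun _ _ => IsLindbladian.add) isLindbladian_zero h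

/-- Each condition is an equality or a weak inequality between continuous functions of `K`.
Closedness is what lets the cone absorb the infinite series over `q`. -/
lemma isClosed_isLindbladian : IsClosed {K : Mat d →L[ℂ] Mat d | IsLindbladian K} := by
  have hc : ∀ a : Mat d, Continuous fun K : Mat d →L[ℂ] Mat d => K a := fun a =>
    (ContinuousLinearMap.apply ℂ (Mat d) a).continuous
  have hchoi : Continuous fun K : Mat d →L[ℂ] Mat d => choi K :=
    continuous_matrix fun p q => (hc _).matrix_elem _ _
  have h : {K : Mat d →L[ℂ] Mat d | IsLindbladian K} =
      ({K | ∀ a, K aᴴ = (K a)ᴴ} ∩ {K | ∀ a, Matrix.trace (K a) = 0}) ∩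
        {K | ∀ z : Fin d × Fin d → ℂ, ∑ i, z (i, i) = 0 → 0 ≤ star z ⬝ᵥ choi K *ᵥ z} := by
    ext K
    exact ⟨fun h => ⟨⟨h.1, h.2⟩, h.3⟩, fun h => ⟨h.1.1, h.1.2, h.2⟩⟩
  rw [h]
  refine (IsClosed.inter ?_ ?_).inter ?_
  · simp only [Set.ofPred_forall]
    exact isClosed_iInter fun a => isClosed_eq (hc _) (hc _).matrix_conjTranspose
  · simp only [Set.ofPred_forall]
    exact isClosed_iInter fun a => isClosed_eq (hc _).matrix_trace continuous_const
  · simp only [Set.ofPred_forall]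
    exact isClosed_iInter fun z => isClosed_iInter fun _ => isClosed_le continuous_const
      (continuous_const.dotProduct (hchoi.matrix_mulVec continuous_const))

lemma isLindbladian_of_hasSum {ι : Type*} {f : ι → Mat d →L[ℂ] Mat d} {K : Mat d →L[ℂ] Mat d}
    (hf : HasSum f K) (h : ∀ i, IsLindbladian (f i)) : IsLindbladian K :=
  isClosed_isLindbladian.mem_of_tendsto hf
    (Filter.Eventually.of_forall fun s => isLindbladian_sum s fun i _ => h i)

lemma dissipator_apply (x y a : Mat d) : dissipator x y a =
    x * (a * yᴴ) - (1 / 2 : ℂ) • (yᴴ * x * a + a * (yᴴ * x)) := by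
  simp [dissipator]

lemma trace_dissipator (x y a : Mat d) : Matrix.trace (dissipator x y a) = 0 := by
  rw [dissipator_apply, Matrix.trace_sub, Matrix.trace_smul, Matrix.trace_add,
    Matrix.trace_mul_comm a (yᴴ * x), ← mul_assoc, Matrix.trace_mul_comm (x * a) yᴴ, ← mul_assoc,
    smul_eq_mul]
  ring

lemma dissipator_conjTranspose (x y a : Mat d) :
    dissipator x y aᴴ = (dissipator y x a)ᴴ := by
  simp [dissipator_apply, mul_assoc, add_comm]

/-- The anticommutator terms carry a factor `∑ i, z (i, i)` or its conjugate and drop out. The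
sandwich term `x a y†` has a rank one Choi matrix, so its form factors into a product of two sums.
With coefficients `c k l` this becomes the quadratic form of `c`. -/
lemma choiForm_dissipator (x y : Mat d) (z : Fin d × Fin d → ℂ) (hz : ∑ i, z (i, i) = 0) :
    star z ⬝ᵥ choi (dissipator x y) *ᵥ z =
      (∑ p, star (z p) * x p.1 p.2) * star (∑ p, star (z p) * y p.1 p.2) := by
  set G := yᴴ * x
  have hchoi : ∀ p q, choi (dissipator x y) p q = x p.1 p.2 * star (y q.1 q.2) -
      (1 / 2) * (G p.1 p.2 * (if q.2 = q.1 then 1 else 0) +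
        (if p.2 = p.1 then 1 else 0) * G q.2 q.1) := by
    rintro ⟨i, k⟩ ⟨j, l⟩
    rw [choi_apply, dissipator_apply]
    simp only [Matrix.sub_apply, Matrix.smul_apply, Matrix.add_apply, smul_eq_mul, Matrix.mul_apply,
      Matrix.single_apply, Matrix.conjTranspose_apply]
    simp [ite_and, G, Matrix.mul_apply]
  have hz1 : ∑ q : Fin d × Fin d, (if q.2 = q.1 then 1 else 0) * z q = 0 := by
    rw [Fintype.sum_prod_type]
    simpa using hz
  have hz2 : ∑ p : Fin d × Fin d, star (z p) * (if p.2 = p.1 then 1 else 0) = 0 := by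
    have := congrArg star hz
    rw [Fintype.sum_prod_type]
    simpa using! this
  have e : star z ⬝ᵥ choi (dissipator x y) *ᵥ z =
      (∑ p, star (z p) * x p.1 p.2) * (∑ q, star (y q.1 q.2) * z q) -
      (1 / 2) * ((∑ p, star (z p) * G p.1 p.2) *
          (∑ q : Fin d × Fin d, (if q.2 = q.1 then 1 else 0) * z q) +
        (∑ p : Fin d × Fin d, star (z p) * (if p.2 = p.1 then 1 else 0)) *
          (∑ q, G q.2 q.1 * z q)) := by
    simp only [Finset.sum_mul_sum]
    simp only [Finset.mul_sum, ← Finset.sum_add_distrib,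
      ← Finset.sum_sub_distrib, dotProduct, Matrix.mulVec]
    refine Finset.sum_congr rfl fun p _ => Finset.sum_congr rfl fun q _ => ?_
    rw [hchoi, Pi.star_apply]
    ring
  rw [e, hz1, hz2, star_sum]
  simp [mul_comm]

/-- A dissipator with a positive semidefinite coefficient matrix is of Lindblad form. -/
lemma isLindbladian_dissipator {κ : Type*} [Fintype κ] {c : Matrix κ κ ℂ} (hc : c.PosSemidef)
    (S : κ → Mat d) : IsLindbladian (∑ k, ∑ l, c k l • dissipator (S k) (S l)) where
  map_conjTranspose a := by
    simp only [sum_apply, smul_apply,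
      Matrix.conjTranspose_sum, Matrix.conjTranspose_smul, dissipator_conjTranspose]
    -- Taking adjoints exchanges the two matrices of a dissipator; after exchanging the indices,
    -- hermiticity of `c` restores the coefficients.
    rw [Finset.sum_comm]
    refine Finset.sum_congr rfl fun k _ => Finset.sum_congr rfl fun l _ => ?_
    rw [hc.isHermitian.apply]
  trace_apply a := by
    simp [Matrix.trace_sum, trace_dissipator]
  nonneg z hz := by
    have h1 : choi (∑ k, ∑ l, c k l • dissipator (S k) (S l)) =
        ∑ k, ∑ l, c k l • choi (dissipator (S k) (S l)) := by
      ext p q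
      simp [choi_apply, Matrix.sum_apply]
    -- By `choiForm_dissipator`, the Choi form at `z` is the form of `c` at this vector of
    -- conjugated sums.
    have h2 := hc.dotProduct_mulVec_nonneg fun k => star (∑ p, star (z p) * S k p.1 p.2)
    have h3 : star z ⬝ᵥ choi (∑ k, ∑ l, c k l • dissipator (S k) (S l)) *ᵥ z =
        star (fun k => star (∑ p, star (z p) * S k p.1 p.2)) ⬝ᵥ c *ᵥ
          fun k => star (∑ p, star (z p) * S k p.1 p.2) := by
      rw [h1]
      simp only [Matrix.sum_mulVec, Matrix.smul_mulVec, dotProduct_sum, dotProduct_smul,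
        choiForm_dissipator _ _ z hz]
      rw [dotProduct]
      simp only [Matrix.mulVec, dotProduct, Finset.mul_sum, Pi.star_apply, star_star, smul_eq_mul]
      refine Finset.sum_congr rfl fun k _ => Finset.sum_congr rfl fun l _ => ?_
      ring
    rw [h3]
    exact h2

/-- A positive semidefinite matrix with a nontrivial kernel is a sum of one rank one matrix less
than its size. -/
lemma exists_eq_sum_of_posSemidef {n : Type*} [Fintype n] [DecidableEq n] {M : Matrix n n ℂ}
    (hM : M.PosSemidef) {e : n → ℂ} (he : e ≠ 0) (hMe : M *ᵥ e = 0) {N : ℕ}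
    (hN : Fintype.card n - 1 = N) :
    ∃ w : Fin N → n → ℂ, ∀ p q, M p q = ∑ k, w k p * star (w k q) := by
  -- A kernel vector forces some eigenvalue to vanish; omitting its term from the spectral
  -- decomposition saves one summand.
  have hdet : M.det = 0 := Matrix.exists_mulVec_eq_zero_iff.1 ⟨e, he, hMe⟩
  rw [hM.isHermitian.det_eq_prod_eigenvalues, Finset.prod_eq_zero_iff] at hdet
  obtain ⟨m, -, hm⟩ := hdet
  have hm' : hM.isHermitian.eigenvalues m = 0 := by simpa using hm
  set U : Matrix n n ℂ := (hM.isHermitian.eigenvectorUnitary : Matrix n n ℂ)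
  have hcard : Fintype.card {k // k ≠ m} = N := by
    rw [← hN]; simp [Fintype.card_subtype_compl]
  let φ := Fintype.equivFinOfCardEq hcard
  -- The remaining eigenvectors, scaled by the roots of their eigenvalues.
  refine ⟨fun k p => √(hM.isHermitian.eigenvalues (φ.symm k)) * U p (φ.symm k), fun p q => ?_⟩
  have h1 : M p q = ∑ k, (hM.isHermitian.eigenvalues k : ℂ) * (U p k * star (U q k)) := by
    conv_lhs => rw [hM.isHermitian.spectral_theorem, Unitary.conjStarAlgAut_apply]
    rw [Matrix.mul_apply]
    refine Finset.sum_congr rfl fun k _ => ?_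
    rw [Matrix.mul_diagonal, Matrix.star_apply]
    simp only [U, Function.comp_apply, Complex.coe_algebraMap]
    ring
  have h2 : ∀ k, (√(hM.isHermitian.eigenvalues k) * U p k) *
      star ((√(hM.isHermitian.eigenvalues k) : ℂ) * U q k) =
        (hM.isHermitian.eigenvalues k : ℂ) * (U p k * star (U q k)) := fun k => by
    have : (√(hM.isHermitian.eigenvalues k) : ℂ) * √(hM.isHermitian.eigenvalues k) =
        hM.isHermitian.eigenvalues k := by
      rw [← Complex.ofReal_mul, Real.mul_self_sqrt (hM.eigenvalues_nonneg k)]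
    rw [star_mul', Complex.star_def, Complex.conj_ofReal, ← this]
    ring
  simp only [h2]
  rw [h1, Equiv.sum_comp φ.symm (fun k : {k // k ≠ m} =>
    (hM.isHermitian.eigenvalues k : ℂ) * (U p k * star (U q k))),
    ← Finset.sum_subtype (Finset.univ.erase m) (by simp) (fun k =>
    (hM.isHermitian.eigenvalues k : ℂ) * (U p k * star (U q k))), Finset.sum_erase]
  rw [hm']; simp

/-- The Choi matrix of a generator is a sum of `d² - 1` rank one matrices, up to terms that come from
maps `a ↦ G a + a G†`. -/
lemma IsLindbladian.exists_choi_eq (hd : 1 ≤ d) {K : Mat d →L[ℂ] Mat d} (hK : IsLindbladian K) :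
    ∃ (v : Fin (d ^ 2 - 1) → Mat d) (G : Mat d), ∀ i k j l, choi K (i, k) (j, l) =
      ∑ m, v m i k * star (v m j l) + G i k * (if j = l then 1 else 0) +
        (if i = k then 1 else 0) * star (G j l) := by
  have hd0 : (d : ℂ) ≠ 0 := by exact_mod_cast (by omega : d ≠ 0)
  set χ := choi K
  have hχ : ∀ p q, star (χ p q) = χ q p := fun p q => by
    have := congrFun₂ (hK.map_conjTranspose (Matrix.single p.2 q.2 1)) q.1 p.1
    rw [Matrix.conjTranspose_single, Matrix.conjTranspose_apply, star_one] at this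
    exact this.symm
  -- The vectorized identity. `P` below is the orthogonal projection onto its complement, that is,
  -- onto the vectorized matrices of trace zero.
  set e : Fin d × Fin d → ℂ := fun p => if p.1 = p.2 then 1 else 0 with he
  have hes : star e = e := by
    ext p; simp only [he, Pi.star_apply]; split_ifs <;> simp
  have hee : e ⬝ᵥ e = d := by
    simp only [dotProduct, he, Fintype.sum_prod_type]
    simp
  set P : Matrix (Fin d × Fin d) (Fin d × Fin d) ℂ := 1 - (d : ℂ)⁻¹ • Matrix.vecMulVec e e with hP
  have hPs : Pᴴ = P := by
    rw [hP, Matrix.conjTranspose_sub, Matrix.conjTranspose_smul, Matrix.conjTranspose_vecMulVec, hes]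
    simp
  have hPmul : ∀ z, P *ᵥ z = z - ((d : ℂ)⁻¹ * (e ⬝ᵥ z)) • e := fun z => by
    rw [hP, Matrix.sub_mulVec, Matrix.smul_mulVec, Matrix.vecMulVec_mulVec, Matrix.one_mulVec]
    ext p
    simp
    ring
  have hPe : P *ᵥ e = 0 := by
    rw [hPmul, hee, inv_mul_cancel₀ hd0]; simp
  have htr : ∀ z : Fin d × Fin d → ℂ, ∑ i, z (i, i) = e ⬝ᵥ z := fun z => by
    simp [dotProduct, he, Fintype.sum_prod_type]
  -- Vectors `P *ᵥ z` are exactly those on which conditional complete positivity gives information.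
  have hM : (P * χ * P).PosSemidef := by
    refine Matrix.PosSemidef.of_dotProduct_mulVec_nonneg ?_ fun z => ?_
    · have hχ' : χᴴ = χ := by ext p q; exact hχ q p
      rw [Matrix.IsHermitian, Matrix.conjTranspose_mul, Matrix.conjTranspose_mul, hPs, hχ', mul_assoc]
    · have h0 := hK.nonneg (P *ᵥ z) (by
        rw [htr, hPmul, dotProduct_sub, dotProduct_smul, hee, smul_eq_mul]
        field_simp
        ring)
      have : star (P *ᵥ z) ⬝ᵥ χ *ᵥ P *ᵥ z = star z ⬝ᵥ (P * χ * P) *ᵥ z := by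
        rw [Matrix.star_mulVec, hPs, ← Matrix.dotProduct_mulVec, Matrix.mulVec_mulVec,
          Matrix.mulVec_mulVec, mul_assoc]
      rwa [this] at h0
  have he0 : e ≠ 0 := fun h => hd0 (by rw [← hee, h]; simp)
  obtain ⟨w, hw⟩ := exists_eq_sum_of_posSemidef hM he0 (N := d ^ 2 - 1)
    (by rw [← Matrix.mulVec_mulVec, hPe, Matrix.mulVec_zero]) (by simp [sq])
  set c := χ *ᵥ e with hc
  set s := e ⬝ᵥ c with hs
  have hcs : ∀ q, (e ᵥ* χ) q = star (c q) := fun q => by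
    have : star c = e ᵥ* χ := by
      have hχ' : χᴴ = χ := by ext p q; exact hχ q p
      rw [hc, Matrix.star_mulVec, hes, hχ']
    rw [← this]; rfl
  have hss : star s = s := by
    rw [hs, ← Matrix.star_dotProduct_star, hes]
    have : star c = e ᵥ* χ := by ext q; exact (hcs q).symm
    rw [this, ← Matrix.dotProduct_mulVec]
  -- Every term of `χ - P χ P` has a factor `e` on the left or on the right, which is the shape of
  -- the Choi matrix of `a ↦ G a + a G†`.
  have hM' : ∀ p q, (P * χ * P) p q = χ p q - (d : ℂ)⁻¹ * (e p * star (c q)) -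
      (d : ℂ)⁻¹ * (c p * e q) + (d : ℂ)⁻¹ * (d : ℂ)⁻¹ * s * (e p * e q) := fun p q => by
    have : P * χ * P = χ - (d : ℂ)⁻¹ • Matrix.vecMulVec e (e ᵥ* χ) -
        (d : ℂ)⁻¹ • Matrix.vecMulVec c e + ((d : ℂ)⁻¹ * (d : ℂ)⁻¹ * s) • Matrix.vecMulVec e e := by
      rw [hP, sub_mul, sub_mul, one_mul, mul_sub, mul_sub, mul_one, mul_one, Matrix.smul_mul,
        Matrix.mul_smul, Matrix.smul_mul, Matrix.mul_smul, Matrix.mul_vecMulVec,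
        Matrix.vecMulVec_mul, Matrix.vecMulVec_mul_vecMulVec, ← Matrix.dotProduct_mulVec, ← hc, ← hs]
      ext p q
      simp only [Matrix.sub_apply, Matrix.add_apply, Matrix.smul_apply, Matrix.vecMulVec_apply,
        smul_eq_mul, Pi.smul_apply]
      ring
    rw [this]
    simp only [Matrix.sub_apply, Matrix.add_apply, Matrix.smul_apply, Matrix.vecMulVec_apply,
      smul_eq_mul, hcs]
  -- The term in `e p * e q` is shared equally between `G` and its adjoint, hence the division by
  -- `2`; this is consistent because `s` is real.
  refine ⟨fun m => Matrix.of fun i k => w m (i, k), Matrix.of fun i k =>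
    (d : ℂ)⁻¹ * c (i, k) - (d : ℂ)⁻¹ * (d : ℂ)⁻¹ * s / 2 * e (i, k), fun i k j l => ?_⟩
  have h1 := hw (i, k) (j, l)
  rw [hM'] at h1
  have h2 : (if j = l then 1 else 0 : ℂ) = e (j, l) := rfl
  have h3 : (if i = k then 1 else 0 : ℂ) = e (i, k) := rfl
  have h4 : star (e (j, l)) = e (j, l) := congrFun hes (j, l)
  simp only [Matrix.of_apply, h2, h3, ← h1, star_sub, star_mul', star_div₀, star_inv₀, h4, hss,
    star_natCast, star_ofNat]
  ring

/-- The theorem of Gorini, Kossakowski, Lindblad and Sudarshan. -/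
theorem IsLindbladian.exists_standardForm (hd : 1 ≤ d) {K : Mat d →L[ℂ] Mat d}
    (hK : IsLindbladian K) : ∃ (h : Mat d) (v : Fin (d ^ 2 - 1) → Mat d), hᴴ = h ∧ ∀ a,
      K a = -(Complex.I • (h * a - a * h)) + ∑ k, (v k * a * (v k)ᴴ -
        (1 / 2 : ℂ) • ((v k)ᴴ * v k * a + a * ((v k)ᴴ * v k))) := by
  obtain ⟨v, G, hvG⟩ := hK.exists_choi_eq hd
  have hKa : ∀ a, K a = ∑ m, v m * a * (v m)ᴴ + G * a + a * Gᴴ := fun a => by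
    ext i j
    rw [apply_eq_sum_choi]
    simp only [hvG, Matrix.add_apply, Matrix.sum_apply, mul_add, Finset.sum_add_distrib]
    congr 1
    · congr 1
      · simp only [Finset.mul_sum, Matrix.mul_apply, Matrix.conjTranspose_apply, Finset.sum_mul]
        rw [Finset.sum_comm]
        refine (Finset.sum_congr rfl fun _ _ => Finset.sum_comm).trans ?_
        rw [Finset.sum_comm]
        refine Finset.sum_congr rfl fun m _ => ?_
        refine Finset.sum_congr rfl fun l _ => Finset.sum_congr rfl fun k _ => ?_
        ring
      · rw [Matrix.mul_apply]
        refine Finset.sum_congr rfl fun k _ => ?_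
        simp [mul_comm]
    · rw [Matrix.mul_apply, Finset.sum_comm]
      refine Finset.sum_congr rfl fun l _ => ?_
      simp
  set W := ∑ m, (v m)ᴴ * v m with hW
  -- By cyclicity, `tr (K a) = tr ((W + G + G†) a)` for every `a`, and the trace pairing is
  -- nondegenerate. So the self-adjoint part of `G` is `-W / 2`, which yields the anticommutator.
  have htr : W + G + Gᴴ = 0 := by
    refine Matrix.ext_iff_trace_mul_right.2 fun a => ?_
    have h0 := hK.trace_apply a
    have h1 : ∑ m, Matrix.trace ((v m)ᴴ * v m * a) = ∑ m, Matrix.trace (v m * a * (v m)ᴴ) :=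
      Finset.sum_congr rfl fun m _ => by rw [Matrix.trace_mul_comm (v m * a), ← mul_assoc]
    rw [hKa, Matrix.trace_add, Matrix.trace_add, Matrix.trace_sum, Matrix.trace_mul_comm a] at h0
    rw [add_mul, add_mul, Matrix.trace_add, Matrix.trace_add, hW, Finset.sum_mul, Matrix.trace_sum,
      zero_mul, Matrix.trace_zero, h1, h0]
  -- Chosen so that `-i h` is the anti-self-adjoint part `(G - G†) / 2` of `G`.
  refine ⟨(Complex.I / 2) • (G - Gᴴ), v, ?_, fun a => ?_⟩
  · rw [Matrix.conjTranspose_smul, Matrix.conjTranspose_sub, Matrix.conjTranspose_conjTranspose,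
      ← neg_sub G, smul_neg, ← neg_smul]
    congr 1
    simp
    ring
  · have hsum : ∑ k, (v k * a * (v k)ᴴ - (1 / 2 : ℂ) • ((v k)ᴴ * v k * a + a * ((v k)ᴴ * v k))) =
        ∑ m, v m * a * (v m)ᴴ - (1 / 2 : ℂ) • (W * a + a * W) := by
      rw [Finset.sum_sub_distrib, ← Finset.smul_sum, Finset.sum_add_distrib, hW, Finset.sum_mul,
        Finset.mul_sum]
    have hW' : W = -(G + Gᴴ) := by rw [← add_eq_zero_iff_eq_neg, ← htr]; abel
    rw [hsum, hKa, hW']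
    simp only [Matrix.smul_mul, Matrix.mul_smul, ← smul_sub, smul_smul]
    have hI : Complex.I * (Complex.I / 2) = -(1 / 2) := by
      rw [mul_div_assoc', Complex.I_mul_I]; norm_num
    rw [hI]
    simp only [sub_mul, mul_sub, add_mul, mul_add, neg_mul, mul_neg]
    module

/-! ### Continuous operator-valued functions -/

section Circle

open AddCircle

variable {T : ℝ}

/-- The pointwise application of an operator-valued function. -/
def applyCircle (A : C(AddCircle T, Mat d →L[ℂ] Mat d)) (g : C(AddCircle T, Mat d)) :
    C(AddCircle T, Mat d) :=
  ⟨fun t => A t (g t), A.continuous.clm_apply g.continuous⟩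

@[simp] lemma applyCircle_apply (A : C(AddCircle T, Mat d →L[ℂ] Mat d)) (g : C(AddCircle T, Mat d))
    (t : AddCircle T) : applyCircle A g t = A t (g t) := rfl

/-- The operator-valued function `t ↦ (a ↦ g t * a * h t)`. -/
def mulLRcircle (g h : C(AddCircle T, Mat d)) : C(AddCircle T, Mat d →L[ℂ] Mat d) :=
  ⟨fun t => mulLR (g t) (h t), by
    have := g.continuous
    have := h.continuous
    refine continuous_clm_apply.2 fun a => ?_
    simp only [mulLR_apply]
    fun_prop⟩

@[simp] lemma mulLRcircle_apply (g h : C(AddCircle T, Mat d)) (t : AddCircle T) (a : Mat d) :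
    mulLRcircle g h t a = g t * (a * h t) := rfl

/-- The pointwise conjugate transpose. -/
def starCircle (g : C(AddCircle T, Mat d)) : C(AddCircle T, Mat d) :=
  ⟨fun t => (g t)ᴴ, by have := g.continuous; fun_prop⟩

@[simp] lemma starCircle_apply (g : C(AddCircle T, Mat d)) (t : AddCircle T) :
    starCircle g t = (g t)ᴴ := rfl

variable [hT : Fact (0 < T)]

variable (d T) in
/-- The class in `𝓛²` of a continuous function. -/
abbrev C0toLp : C(AddCircle T, Mat d) →L[ℂ] FloquetSpace d T :=
  ContinuousMap.toLp (E := Mat d) 2 (haarAddCircle (T := T)) ℂ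

lemma C0toLp_ae (g : C(AddCircle T, Mat d)) : C0toLp d T g =ᵐ[haarAddCircle] g :=
  ContinuousMap.coeFn_toLp (p := 2) (𝕜 := ℂ) haarAddCircle g

variable (d T) in
/-- The operators of continuous operator-valued functions, as a linear map. -/
def continuousOpL : C(AddCircle T, Mat d →L[ℂ] Mat d) →ₗ[ℂ]
    FloquetSpace d T →L[ℂ] FloquetSpace d T :=
  ((ContinuousLinearMap.id ℂ (Mat d →L[ℂ] Mat d)).holderL haarAddCircle ∞ 2 2).toLinearMap ∘ₗ
    (ContinuousMap.toLp ∞ haarAddCircle ℂ).toLinearMap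

lemma continuousOpL_apply (A : C(AddCircle T, Mat d →L[ℂ] Mat d)) :
    continuousOpL d T A = continuousOp A := rfl

lemma continuousOp_C0toLp (A : C(AddCircle T, Mat d →L[ℂ] Mat d)) (g : C(AddCircle T, Mat d)) :
    continuousOp A (C0toLp d T g) = C0toLp d T (applyCircle A g) := by
  ext1
  filter_upwards [continuousOp_ae A (C0toLp d T g), C0toLp_ae g, C0toLp_ae (applyCircle A g)]
    with t h1 h2 h3
  rw [h1, h2, h3, applyCircle_apply]

variable (d T) in
/-- The class in `L^∞` of a continuous function. -/
abbrev C0toLinfty : C(AddCircle T, Mat d) →L[ℂ] Lp (Mat d) ∞ (haarAddCircle (T := T)) :=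
  ContinuousMap.toLp (E := Mat d) ∞ (haarAddCircle (T := T)) ℂ

lemma C0toLinfty_ae (g : C(AddCircle T, Mat d)) : C0toLinfty d T g =ᵐ[haarAddCircle] g :=
  ContinuousMap.coeFn_toLp (p := ∞) (𝕜 := ℂ) haarAddCircle g

lemma adjoint_C0toLinfty (g : C(AddCircle T, Mat d)) :
    adjoint (C0toLinfty d T g) = C0toLinfty d T (starCircle g) := by
  ext1
  filter_upwards [(conjTransposeL d).coeFn_compLp (C0toLinfty d T g), C0toLinfty_ae g,
    C0toLinfty_ae (starCircle g)] with t h1 h2 h3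
  rw [h3, adjoint, h1, h2]
  rfl

lemma iota_lmul (g : C(AddCircle T, Mat d)) (x : TensorSpace d T) :
    iota (lmul (C0toLinfty d T g) x) = continuousOp (mulLRcircle g 1) (iota x) := by
  ext1
  filter_upwards [iota_lmul_ae (C0toLinfty d T g) x, C0toLinfty_ae g,
    continuousOp_ae (mulLRcircle g 1) (iota x)] with t h1 h2 h3
  rw [h1, h2, h3]
  simp

lemma iota_rmul (g : C(AddCircle T, Mat d)) (x : TensorSpace d T) :
    iota (rmul (C0toLinfty d T g) x) = continuousOp (mulLRcircle 1 g) (iota x) := by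
  ext1
  filter_upwards [iota_rmul_ae (C0toLinfty d T g) x, C0toLinfty_ae g,
    continuousOp_ae (mulLRcircle 1 g) (iota x)] with t h1 h2 h3
  rw [h1, h2, h3]
  simp

lemma continuousOp_continuousOp {A B C : C(AddCircle T, Mat d →L[ℂ] Mat d)}
    (h : ∀ t a, A t (B t a) = C t a) (f : FloquetSpace d T) :
    continuousOp A (continuousOp B f) = continuousOp C f := by
  ext1
  filter_upwards [continuousOp_ae A (continuousOp B f), continuousOp_ae B f, continuousOp_ae C f]
    with t h1 h2 h3
  rw [h1, h2, h3, h]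

/-- The lifting of a continuous family of generators in standard form is of standard form. -/
lemma isStandardForm_lifting (A : C(AddCircle T, Mat d →L[ℂ] Mat d)) (h : C(AddCircle T, Mat d))
    (v : Fin (d ^ 2 - 1) → C(AddCircle T, Mat d)) (hh : ∀ t, (h t)ᴴ = h t)
    (hA : ∀ t a, A t a = -(Complex.I • (h t * a - a * h t)) + ∑ k, (v k t * a * (v k t)ᴴ -
      (1 / 2 : ℂ) • ((v k t)ᴴ * v k t * a + a * ((v k t)ᴴ * v k t)))) :
    IsStandardForm (lifting (continuousOp A)) := by
  refine ⟨C0toLinfty d T h, fun k => C0toLinfty d T (v k), ?_, fun x => ?_⟩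
  · rw [adjoint_C0toLinfty]
    congr 1
    ext1 t
    exact hh t
  · apply (iota (d := d) (T := T)).injective
    -- The pointwise formula is an identity in the linear space of continuous operator-valued
    -- functions, so the linear map `continuousOpL` carries it to operators. Only the products of
    -- multiplication operators need separate treatment.
    have hA' : A = -(Complex.I • (mulLRcircle h 1 - mulLRcircle 1 h)) +
        ∑ k, (mulLRcircle (v k) (starCircle (v k)) - (1 / 2 : ℂ) •
          (mulLRcircle (starCircle (v k) * v k) 1 + mulLRcircle 1 (starCircle (v k) * v k))) := by
      ext1 t
      ext1 a
      rw [hA]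
      simp [ContinuousMap.sum_apply, sum_apply, mul_assoc]
    have e1 : ∀ k, continuousOp (mulLRcircle (v k) 1)
        (continuousOp (mulLRcircle 1 (starCircle (v k))) (iota x)) =
          continuousOp (mulLRcircle (v k) (starCircle (v k))) (iota x) := fun k =>
      continuousOp_continuousOp (by simp) _
    have e2 : ∀ k, continuousOp (mulLRcircle (starCircle (v k)) 1)
        (continuousOp (mulLRcircle (v k) 1) (iota x)) =
          continuousOp (mulLRcircle (starCircle (v k) * v k) 1) (iota x) := fun k =>
      continuousOp_continuousOp (by simp [mul_assoc]) _
    have e3 : ∀ k, continuousOp (mulLRcircle 1 (v k))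
        (continuousOp (mulLRcircle 1 (starCircle (v k))) (iota x)) =
          continuousOp (mulLRcircle 1 (starCircle (v k) * v k)) (iota x) := fun k =>
      continuousOp_continuousOp (by simp [mul_assoc]) _
    rw [iota_lifting, ← continuousOpL_apply]
    simp only [adjoint_C0toLinfty, map_add, map_neg, map_smul, map_sub, map_sum, iota_lmul,
      iota_rmul, e1, e2, e3]
    conv_lhs => rw [hA']
    simp only [map_add, map_neg, map_smul, map_sub, map_sum, continuousOpL_apply,
      add_apply, neg_apply, smul_apply, sub_apply, sum_apply]

end Circle

/-! ### The time-dependent generator in standard form -/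

namespace PeriodicSystem

variable {T : ℝ} {κ : Type*} [Fintype κ] (X : PeriodicSystem d T κ)

/-- Positivity is available only after summing over both `k` and `l` at fixed `q` and `ω`, so the
finite sums are moved inside the series over `q` and then regrouped by frequency. -/
lemma isLindbladian_K : IsLindbladian X.K := by
  have h : HasSum (fun q : ℤ => ∑ k, ∑ l,
      daviesTerm T (bohrFrequencies X.Hbar_hermitian) X.γ X.S k l q) X.K :=
    hasSum_sum fun k _ => hasSum_sum fun l _ => (X.summable k l).hasSum
  refine isLindbladian_of_hasSum h fun q => ?_
  have e : ∑ k, ∑ l, daviesTerm T (bohrFrequencies X.Hbar_hermitian) X.γ X.S k l q =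
      ∑ ω ∈ bohrFrequencies X.Hbar_hermitian, ∑ k, ∑ l,
        X.γ (ω + q * (2 * Real.pi / T)) k l • dissipator (X.S k q ω) (X.S l q ω) := by
    simp only [daviesTerm]
    rw [Finset.sum_comm]
    refine (Finset.sum_congr rfl fun _ _ => Finset.sum_comm).trans ?_
    rw [Finset.sum_comm]
    exact Finset.sum_congr rfl fun _ _ => Finset.sum_comm
  rw [e]
  exact isLindbladian_sum _ fun ω hω =>
    isLindbladian_dissipator (X.γ_posSemidef ω hω q) fun k => X.S k q ω

lemma P_apply (t : ℝ) (a : Mat d) : X.P t a = X.p t * a * (X.p t)ᴴ := by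
  rw [P, mulLR_apply, mul_assoc]

/-- Multiplicativity comes from unitarity of `p t`. Together with `P_conjTranspose` it lets `P t`
pass through every product and adjoint in the standard form. -/
lemma P_mul (t : ℝ) (a b : Mat d) : X.P t (a * b) = X.P t a * X.P t b := by
  rw [P_apply, P_apply, P_apply]
  calc X.p t * (a * b) * (X.p t)ᴴ = X.p t * a * 1 * b * (X.p t)ᴴ := by
        simp only [mul_one, mul_assoc]
    _ = _ := by rw [← X.p_star_mul_self t]; simp only [mul_assoc]

lemma P_conjTranspose (t : ℝ) (a : Mat d) : X.P t aᴴ = (X.P t a)ᴴ := by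
  simp [P_apply, mul_assoc]

lemma P_Pinv (t : ℝ) (a : Mat d) : X.P t (X.Pinv t a) = a :=
  DFunLike.congr_fun (X.P_comp_Pinv t) a

variable [hT : Fact (0 < T)]

/-- One decomposition of `K` serves all times: the coefficients at time `t` are `H t + P t h` and `P
t (v k)`. They are continuous on the compact circle, hence bounded, and no choice depending on `t`
is made. -/
theorem isStandardForm_Ltilde (hd : 1 ≤ d) : IsStandardForm X.Ltilde := by
  obtain ⟨h, v, hh, hK⟩ := X.isLindbladian_K.exists_standardForm hd
  have hc : ∀ a, Continuous fun t : AddCircle T => X.Pcircle t a := fun a =>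
    X.Pcircle.continuous.clm_apply continuous_const
  refine isStandardForm_lifting X.Lcircle
    (circleLift X.H X.H_periodic X.H_continuous + ⟨fun t => X.Pcircle t h, hc h⟩)
    (fun k => ⟨fun t => X.Pcircle t (v k), hc (v k)⟩) (fun t => ?_) (fun t a => ?_)
  · induction t using QuotientAddGroup.induction_on with
    | H t =>
      have h1 : (X.H t)ᴴ = X.H t := X.H_hermitian t
      have h2 : (X.P t h)ᴴ = X.P t h := by rw [← P_conjTranspose, hh]
      exact (Matrix.conjTranspose_add _ _).trans (congrArg₂ (· + ·) h1 h2)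
  · induction t using QuotientAddGroup.induction_on with
    | H t =>
      have e : X.L t a = -(Complex.I • ((X.H t + X.P t h) * a - a * (X.H t + X.P t h))) +
          ∑ k, (X.P t (v k) * a * (X.P t (v k))ᴴ - (1 / 2 : ℂ) •
            ((X.P t (v k))ᴴ * X.P t (v k) * a + a * ((X.P t (v k))ᴴ * X.P t (v k)))) := by
        have e1 : X.L t a = -(Complex.I • (X.H t * a - a * X.H t)) +
            X.P t (X.K (X.Pinv t a)) := by simp [L, adMap]
        rw [e1, hK]
        simp only [map_add, map_neg, map_smul, map_sub, map_sum, P_mul, P_conjTranspose, P_Pinv,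
          add_mul, mul_add, ← add_assoc]
        congr 1
        module
      exact e

end PeriodicSystem

/-! ### The Fourier series of an operator-valued function -/

section Circle

open AddCircle

variable {T : ℝ}

/-- The product of a continuous function with a fixed map of matrices. -/
def smulCircle (g : C(AddCircle T, ℂ)) (A : Mat d →L[ℂ] Mat d) :
    C(AddCircle T, Mat d →L[ℂ] Mat d) :=
  ⟨fun t => g t • A, g.continuous.smul continuous_const⟩

@[simp] lemma smulCircle_apply (g : C(AddCircle T, ℂ)) (A : Mat d →L[ℂ] Mat d) (t : AddCircle T) :
    smulCircle g A t = g t • A := rfl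

variable [hT : Fact (0 < T)]

/-- On an elementary tensor both sides are the function `e_n(t) h(t) A a`. This turns the terms `L_n
⊗ F_n` into pointwise operators. -/
lemma iota_map_fourierShift (A : Mat d →L[ℂ] Mat d) (n : ℤ) (x : TensorSpace d T) :
    iota (TensorProduct.map A.toLinearMap (fourierShift T n).toLinearMap x) =
      continuousOp (smulCircle (fourier n) A) (iota x) := by
  induction x using TensorProduct.induction_on with
  | zero => simp
  | add x y hx hy => rw [map_add, map_add, hx, hy, map_add, map_add]
  | tmul a h =>
    rw [TensorProduct.map_tmul, iota_tmul, iota_tmul]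
    ext1
    have h1 := ContinuousLinearMap.coeFn_holder (r := 2) (ContinuousLinearMap.mul ℂ ℂ)
      (fourierLp (T := T) ∞ n) h
    filter_upwards [h1, coeFn_fourierLp (T := T) ∞ n, odot_ae (A a) (fourierShift T n h),
      odot_ae a h, continuousOp_ae (smulCircle (fourier n) A) (odot a h)] with t h1 h2 h3 h4 h5
    have h6 : (fourierShift T n h) t = fourier n t * h t := h1.trans (by rw [h2]; rfl)
    refine h3.trans ?_
    rw [h5, h4, h6, smulCircle_apply, smul_apply, map_smul, smul_smul]

lemma iota_map_id (A : Mat d →L[ℂ] Mat d) (x : TensorSpace d T) :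
    iota (TensorProduct.map A.toLinearMap LinearMap.id x) =
      continuousOp (ContinuousMap.const _ A) (iota x) := by
  induction x using TensorProduct.induction_on with
  | zero => simp
  | add x y hx hy => rw [map_add, map_add, hx, hy, map_add, map_add]
  | tmul a h =>
    rw [TensorProduct.map_tmul, iota_tmul, iota_tmul]
    ext1
    filter_upwards [odot_ae (A a) h, odot_ae a h,
      continuousOp_ae (ContinuousMap.const _ A) (odot a h)] with t h3 h4 h5
    refine h3.trans ?_
    rw [h5, h4, ContinuousMap.const_apply, map_smul]

lemma fourierCoeff_clm {E F : Type*} [NormedAddCommGroup E] [NormedSpace ℂ E]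
    [NormedAddCommGroup F] [NormedSpace ℂ F] [CompleteSpace E] [CompleteSpace F] (φ : E →L[ℂ] F)
    (f : C(AddCircle T, E)) (n : ℤ) :
    fourierCoeff (fun t => φ (f t)) n = φ (fourierCoeff f n) := by
  have hi : Integrable (fun t => fourier (-n) t • f t) (haarAddCircle (T := T)) :=
    Continuous.integrable_of_hasCompactSupport (by fun_prop) (HasCompactSupport.of_compactSpace _)
  rw [fourierCoeff, fourierCoeff, ← φ.integral_comp_comm hi]
  simp

/-- Multiplication of a scalar function by a continuous matrix-valued function. -/
def smulOp (f : C(AddCircle T, Mat d)) : L2Circle T →L[ℂ] FloquetSpace d T :=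
  (ContinuousLinearMap.lsmul ℂ ℂ).flip.holderL haarAddCircle ∞ 2 2 (C0toLinfty d T f)

lemma smulOp_toLp (f : C(AddCircle T, Mat d)) (g : C(AddCircle T, ℂ)) :
    smulOp f (ContinuousMap.toLp (E := ℂ) 2 haarAddCircle ℂ g) = C0toLp d T (g • f) := by
  ext1
  have h := ContinuousLinearMap.coeFn_holder (r := 2)
    (ContinuousLinearMap.lsmul ℂ ℂ : ℂ →L[ℂ] Mat d →L[ℂ] Mat d).flip (C0toLinfty d T f)
    (ContinuousMap.toLp (E := ℂ) 2 haarAddCircle ℂ g)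
  filter_upwards [h, C0toLinfty_ae f, C0toLp_ae (g • f),
    ContinuousMap.coeFn_toLp (p := 2) (𝕜 := ℂ) haarAddCircle g] with t h1 h2 h3 h4
  rw [h3]
  refine h1.trans ?_
  rw [h2, h4]
  rfl

/-- The Fourier series of a continuous operator-valued function converges strongly on continuous
functions. -/
lemma hasSum_fourier_continuousOp (A : C(AddCircle T, Mat d →L[ℂ] Mat d))
    (f : C(AddCircle T, Mat d)) :
    HasSum (fun n : ℤ => continuousOp (smulCircle (fourier n) (fourierCoeff A n)) (C0toLp d T f))
      (continuousOp A (C0toLp d T f)) := by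
  -- Coordinates in the finite-dimensional space of maps of matrices reduce the claim to scalar
  -- Fourier series.
  let b := Module.finBasis ℂ (Mat d →L[ℂ] Mat d)
  let φ : ∀ i, (Mat d →L[ℂ] Mat d) →L[ℂ] ℂ := fun i => LinearMap.toContinuousLinearMap (b.coord i)
  let l : ∀ i, C(AddCircle T, ℂ) := fun i => ⟨fun t => φ i (A t), by fun_prop⟩
  let bf : ∀ i, C(AddCircle T, Mat d) := fun i => ⟨fun t => b i (f t), by fun_prop⟩
  have hφ : ∀ B, ∑ i, φ i B • b i = B := fun B => b.sum_repr B
  -- The scalar series converges only in `L²`, so its image converges because multiplication by `b i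
  -- f` is bounded; continuity of `f` is what makes this multiplier bounded.
  have h1 : ∀ i, HasSum (fun n : ℤ => smulOp (bf i) (φ i (fourierCoeff A n) • fourierLp 2 n))
      (smulOp (bf i) (ContinuousMap.toLp (E := ℂ) 2 haarAddCircle ℂ (l i))) := fun i => by
    have := (hasSum_fourier_series_L2 (ContinuousMap.toLp (E := ℂ) 2 haarAddCircle ℂ (l i))).mapL
      (smulOp (bf i))
    simp only [fourierCoeff_toLp] at this
    have e : ∀ n, fourierCoeff (l i) n = φ i (fourierCoeff A n) := fun n =>
      fourierCoeff_clm (φ i) A n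
    simpa only [e] using this
  have h2 := hasSum_sum (s := Finset.univ) fun i _ => h1 i
  have e1 : ∑ i, smulOp (bf i) (ContinuousMap.toLp (E := ℂ) 2 haarAddCircle ℂ (l i)) =
      continuousOp A (C0toLp d T f) := by
    simp only [smulOp_toLp]
    rw [continuousOp_C0toLp, ← map_sum]
    congr 1
    ext1 t
    rw [applyCircle_apply]
    conv_rhs => rw [← hφ (A t)]
    simp [ContinuousMap.sum_apply, sum_apply, l, bf]
  have e2 : ∀ n : ℤ, ∑ i, smulOp (bf i) (φ i (fourierCoeff A n) • fourierLp 2 n) =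
      continuousOp (smulCircle (fourier n) (fourierCoeff A n)) (C0toLp d T f) := fun n => by
    simp only [fourierLp, map_smul, smulOp_toLp]
    simp only [← map_smul]
    rw [continuousOp_C0toLp, ← map_sum]
    congr 1
    ext1 t
    rw [applyCircle_apply, smulCircle_apply]
    conv_rhs => rw [← hφ (fourierCoeff A n)]
    simp [ContinuousMap.sum_apply, sum_apply, bf, Finset.smul_sum, smul_smul, mul_comm]
  simpa only [e1, e2] using h2

lemma hasSum_map_fourierShift (A : C(AddCircle T, Mat d →L[ℂ] Mat d)) {x : TensorSpace d T}
    (hx : x ∈ tensorC0 d T) :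
    HasSum (fun n : ℤ => TensorProduct.map (fourierCoeff A n).toLinearMap
      (fourierShift T n).toLinearMap x) (lifting (continuousOp A) x) := by
  obtain ⟨f, hf⟩ := hx
  have hf' : C0toLp d T f = iota x := hf
  have h := hasSum_fourier_continuousOp A f
  rw [hf', ← iota_lifting] at h
  simp only [← iota_map_fourierShift] at h
  have h' := h.mapL (iota (d := d) (T := T)).symm.toContinuousLinearEquiv.toContinuousLinearMap
  have e : ∀ y : TensorSpace d T, (iota (d := d) (T := T)).symm.toContinuousLinearEquiv.toContinuousLinearMap
      (iota y) = y := fun y => (iota (d := d) (T := T)).symm_apply_apply y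
  simpa only [e] using h'

end Circle

/-! ### The number operator on continuously differentiable functions -/

section Circle

open AddCircle

variable {T : ℝ} [hT : Fact (0 < T)]

lemma I_mul_frequency_ne_zero : Complex.I * (2 * Real.pi / T : ℝ) ≠ 0 := by
  have h : 2 * Real.pi / T ≠ 0 := (div_pos (by positivity) hT.out).ne'
  exact mul_ne_zero Complex.I_ne_zero (by exact_mod_cast h)

/-- The Fourier coefficients of a derivative. -/
lemma fourierCoeff_of_hasDerivAt {f g : C(AddCircle T, ℂ)}
    (h : ∀ t : ℝ, HasDerivAt (fun s : ℝ => f (s : AddCircle T)) (g (t : AddCircle T)) t) (n : ℤ) :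
    fourierCoeff g n = Complex.I * (2 * Real.pi / T : ℝ) * (n * fourierCoeff f n) := by
  rw [fourierCoeff_eq_intervalIntegral g n 0, fourierCoeff_eq_intervalIntegral f n 0]
  have hmk : Continuous fun s : ℝ => (s : AddCircle T) := AddCircle.continuous_mk' T
  have hF : Continuous fun s : ℝ => fourier (-n) (s : AddCircle T) :=
    (fourier (-n)).continuous.comp hmk
  have hg : Continuous fun s : ℝ => g (s : AddCircle T) := g.continuous.comp hmk
  -- Integration by parts over one period; the boundary terms cancel by periodicity (`h2`).
  have h1 := intervalIntegral.integral_mul_deriv_eq_deriv_mul (a := 0) (b := 0 + T)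
    (fun s _ => hasDerivAt_fourier_neg T n s) (fun s _ => h s)
    ((continuous_const.mul hF).intervalIntegrable _ _) (hg.intervalIntegrable _ _)
  have h2 : ((0 + T : ℝ) : AddCircle T) = ((0 : ℝ) : AddCircle T) := by simp
  simp only [smul_eq_mul]
  rw [h1, h2, sub_self, zero_sub]
  simp only [mul_assoc, intervalIntegral.integral_const_mul]
  simp only [Complex.real_smul]
  push_cast
  ring

/-- Up to the constant `(iΩ)⁻¹`, the sequence `n f̂(n)` consists of the Fourier coefficients of the
continuous function `g`, hence is square summable. -/
lemma toLp_mem_fourierNumber_domain {f g : C(AddCircle T, ℂ)}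
    (h : ∀ t : ℝ, HasDerivAt (fun s : ℝ => f (s : AddCircle T)) (g (t : AddCircle T)) t) :
    ContinuousMap.toLp (E := ℂ) 2 haarAddCircle ℂ f ∈ (fourierNumber T).domain := by
  rw [mem_fourierNumber_domain]
  have h1 := Memℓp.const_smul (lp.memℓp ((fourierBasis (T := T)).repr
    (ContinuousMap.toLp (E := ℂ) 2 haarAddCircle ℂ g))) (Complex.I * (2 * Real.pi / T : ℝ))⁻¹
  convert! h1 using 1
  ext n
  rw [Pi.smul_apply, fourierBasis_repr, fourierCoeff_toLp, fourierCoeff_toLp,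
    fourierCoeff_of_hasDerivAt h, smul_eq_mul, inv_mul_cancel_left₀ I_mul_frequency_ne_zero]

lemma smul_fourierNumber_toLp {f g : C(AddCircle T, ℂ)}
    (h : ∀ t : ℝ, HasDerivAt (fun s : ℝ => f (s : AddCircle T)) (g (t : AddCircle T)) t) :
    (Complex.I * (2 * Real.pi / T : ℝ)) • fourierNumber T
      ⟨ContinuousMap.toLp (E := ℂ) 2 haarAddCircle ℂ f, toLp_mem_fourierNumber_domain h⟩ =
        ContinuousMap.toLp (E := ℂ) 2 haarAddCircle ℂ g := by
  apply (fourierBasis (T := T)).repr.injective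
  ext n
  rw [map_smul, lp.coeFn_smul, Pi.smul_apply, fourierBasis_repr, fourierBasis_repr,
    fourierCoeff_fourierNumber, fourierCoeff_toLp, fourierCoeff_toLp, fourierCoeff_of_hasDerivAt h,
    smul_eq_mul]

/-- The matrix entry of a continuous function. -/
def entryCircle (i j : Fin d) (f : C(AddCircle T, Mat d)) : C(AddCircle T, ℂ) :=
  ⟨fun t => entry i j (f t), by fun_prop⟩

lemma iota_symm_C0toLp (f : C(AddCircle T, Mat d)) : (iota (d := d) (T := T)).symm (C0toLp d T f) =
    ∑ i, ∑ j, (Matrix.single i j 1 : Mat d) ⊗ₜ[ℂ]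
      ContinuousMap.toLp (E := ℂ) 2 haarAddCircle ℂ (entryCircle i j f) := by
  refine (iotaInv_apply (C0toLp d T f)).trans ?_
  refine Finset.sum_congr rfl fun i _ => Finset.sum_congr rfl fun j _ => ?_
  congr 1

lemma hasDerivAt_C1 (f : C1 d T) (t : ℝ) :
    HasDerivAt (fun s : ℝ => (f : C(AddCircle T, Mat d)) (s : AddCircle T))
      (derivC1 f (t : AddCircle T)) t :=
  (((contDiff_C1 f).differentiable one_ne_zero) t).hasDerivAt

lemma hasDerivAt_entryCircle (f : C1 d T) (i j : Fin d) (t : ℝ) :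
    HasDerivAt (fun s : ℝ => entryCircle i j (f : C(AddCircle T, Mat d)) (s : AddCircle T))
      (entryCircle i j (derivC1 f) (t : AddCircle T)) t :=
  ((entry (d := d) i j).restrictScalars ℝ).hasFDerivAt.comp_hasDerivAt t (hasDerivAt_C1 f t)

/-- A preimage of a continuously differentiable function in `ℂ^{d×d} ⊗ D(F_z)`. -/
def preC1 (f : C1 d T) : Mat d ⊗[ℂ] (fourierNumber T).domain :=
  ∑ i, ∑ j, (Matrix.single i j 1 : Mat d) ⊗ₜ[ℂ]
    (⟨_, toLp_mem_fourierNumber_domain (hasDerivAt_entryCircle f i j)⟩ : (fourierNumber T).domain)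

lemma lTensor_preC1 (f : C1 d T) :
    LinearMap.lTensor (Mat d) (fourierNumber T).domain.subtype (preC1 f) =
      (iota (d := d) (T := T)).symm (C1toLp d T f) := by
  refine Eq.trans ?_ (iota_symm_C0toLp (f : C(AddCircle T, Mat d))).symm
  simp [preC1]

lemma mem_idTensorNumberMax_domain (f : C1 d T) :
    (iota (d := d) (T := T)).symm (C1toLp d T f) ∈ (idTensorNumberMax d T).domain :=
  ⟨preC1 f, lTensor_preC1 f⟩

lemma smul_idTensorNumberMax (f : C1 d T)
    (h : (iota (d := d) (T := T)).symm (C1toLp d T f) ∈ (idTensorNumberMax d T).domain) :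
    (Complex.I * (2 * Real.pi / T : ℝ)) • idTensorNumberMax d T ⟨_, h⟩ =
      (iota (d := d) (T := T)).symm (C0toLp d T (derivC1 f)) := by
  -- The operator is defined through the inverse of an injection, so its value is read off at the
  -- explicit preimage `preC1 f`.
  have e : idTensorNumberMax d T ⟨_, h⟩ =
      LinearMap.lTensor (Mat d) (fourierNumber T).toFun (preC1 f) := by
    rw [← pmapOfInjective_apply (LinearMap.lTensor (Mat d) (fourierNumber T).domain.subtype)
      (Module.Flat.lTensor_preserves_injective_linearMap _ (Submodule.injective_subtype _))]
    exact congrArg (idTensorNumberMax d T).toFun (Subtype.ext (lTensor_preC1 f).symm)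
  rw [e, iota_symm_C0toLp, preC1]
  simp only [map_sum, LinearMap.lTensor_tmul, Finset.smul_sum, ← TensorProduct.tmul_smul]
  refine Finset.sum_congr rfl fun i _ => Finset.sum_congr rfl fun j _ => ?_
  congr 1
  exact smul_fourierNumber_toLp (hasDerivAt_entryCircle f i j)

lemma exists_of_mem_tensorC1 {x : TensorSpace d T} (hx : x ∈ tensorC1 d T) :
    ∃ f : C1 d T, x = (iota (d := d) (T := T)).symm (C1toLp d T f) := by
  obtain ⟨f, hf⟩ := hx
  refine ⟨f, ?_⟩
  rw [hf]
  exact ((iota (d := d) (T := T)).symm_apply_apply x).symm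

lemma mem_tensorC1 (f : C1 d T) :
    (iota (d := d) (T := T)).symm (C1toLp d T f) ∈ tensorC1 d T :=
  ⟨f, ((iota (d := d) (T := T)).apply_symm_apply _).symm⟩

/-- Restriction intersects `ι⁻¹(C¹)` with the maximal domain; nothing is lost, since the entries of
a `C¹` function lie in the domain of `F_z`. -/
lemma idTensorNumber_domain : (idTensorNumber d T).domain = tensorC1 d T := by
  refine inf_eq_left.2 fun x hx => ?_
  obtain ⟨f, rfl⟩ := exists_of_mem_tensorC1 hx
  exact mem_idTensorNumberMax_domain f

/-- On `C¹` functions, `i Ω I ⊗ F_z` is the derivative. -/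
lemma smul_idTensorNumber (f : C1 d T)
    (h : (iota (d := d) (T := T)).symm (C1toLp d T f) ∈ (idTensorNumber d T).domain) :
    (Complex.I * (2 * Real.pi / T : ℝ)) • idTensorNumber d T ⟨_, h⟩ =
      (iota (d := d) (T := T)).symm (C0toLp d T (derivC1 f)) :=
  smul_idTensorNumberMax f h.2

/-- The operators `Ã - i Ω I ⊗ F_z`. -/
lemma toPMap_sub_idTensorNumber_domain (A : TensorSpace d T →ₗ[ℂ] TensorSpace d T) :
    (A.toPMap ⊤ - (Complex.I * (2 * Real.pi / T : ℝ)) • idTensorNumber d T).domain =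
      tensorC1 d T := by
  rw [LinearPMap.sub_domain, LinearPMap.smul_domain, idTensorNumber_domain]
  exact top_inf_eq _

lemma toPMap_sub_idTensorNumber_apply (A : TensorSpace d T →ₗ[ℂ] TensorSpace d T) (f : C1 d T)
    (h : (iota (d := d) (T := T)).symm (C1toLp d T f) ∈
      (A.toPMap ⊤ - (Complex.I * (2 * Real.pi / T : ℝ)) • idTensorNumber d T).domain) :
    (A.toPMap ⊤ - (Complex.I * (2 * Real.pi / T : ℝ)) • idTensorNumber d T) ⟨_, h⟩ =
      A ((iota (d := d) (T := T)).symm (C1toLp d T f)) -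
        (iota (d := d) (T := T)).symm (C0toLp d T (derivC1 f)) :=
  (LinearPMap.sub_apply _ _ ⟨_, h⟩).trans
    (congrArg (_ - ·) (smul_idTensorNumber f h.2))

/-- Operators with domain `ι⁻¹(C¹)` are equal if they agree on it. -/
lemma pmap_ext_tensorC1 {A B : TensorSpace d T →ₗ.[ℂ] TensorSpace d T}
    (hA : A.domain = tensorC1 d T) (hB : B.domain = tensorC1 d T)
    (h : ∀ (f : C1 d T) (hA : (iota (d := d) (T := T)).symm (C1toLp d T f) ∈ A.domain)
      (hB : (iota (d := d) (T := T)).symm (C1toLp d T f) ∈ B.domain), A ⟨_, hA⟩ = B ⟨_, hB⟩) :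
    A = B := by
  refine LinearPMap.ext (hA.trans hB.symm) fun x hxA hxB => ?_
  obtain ⟨f, rfl⟩ := exists_of_mem_tensorC1 (hA ▸ hxA)
  exact h f hxA hxB

lemma lifting_iota_symm (A : FloquetSpace d T →L[ℂ] FloquetSpace d T) (f : FloquetSpace d T) :
    lifting A ((iota (d := d) (T := T)).symm f) = (iota (d := d) (T := T)).symm (A f) := by
  apply (iota (d := d) (T := T)).injective
  rw [iota_lifting, LinearIsometryEquiv.apply_symm_apply, LinearIsometryEquiv.apply_symm_apply]

end Circle

/-! ### Derivatives of matrix-valued functions -/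

section

open scoped Matrix.Norms.L2Operator

/-- The operator norm of this section supplies the normed algebra needed for the product rule and
for the derivative of the exponential. Derivatives depend only on the topology, which is also that
of the trace norm. -/
lemma hasDerivAt_mul_exp {H u : ℝ → Mat d} {t : ℝ}
    (hu : HasDerivAt u (-(Complex.I • (H t * u t))) t) (A : Mat d) :
    HasDerivAt (fun s : ℝ => u s * NormedSpace.exp (((s : ℂ) * Complex.I) • A))
      (-(Complex.I • (H t * (u t * NormedSpace.exp (((t : ℂ) * Complex.I) • A)))) +
        Complex.I • (u t * NormedSpace.exp (((t : ℂ) * Complex.I) • A) * A)) t := by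
  have e : ∀ s : ℝ, ((s : ℂ) * Complex.I) • A = s • (Complex.I • A) := fun s => by
    rw [mul_smul]; rfl
  simp only [e]
  have h := hu.mul (hasDerivAt_exp_smul_const (𝕂 := ℝ) (Complex.I • A) t)
  refine h.congr_deriv ?_
  simp [mul_assoc]

lemma hasDerivAt_mul {f g : ℝ → Mat d} {f' g' : Mat d} {t : ℝ} (hf : HasDerivAt f f' t)
    (hg : HasDerivAt g g' t) : HasDerivAt (fun s => f s * g s) (f' * g t + f t * g') t :=
  hf.mul hg

lemma hasDerivAt_conjTranspose {f : ℝ → Mat d} {f' : Mat d} {t : ℝ} (hf : HasDerivAt f f' t) :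
    HasDerivAt (fun s => (f s)ᴴ) f'ᴴ t :=
  HasDerivAt.star hf

end

/-- The class in `𝓛²` of the derivative of a continuously differentiable function. -/
def derivToLp (d : ℕ) (T : ℝ) [hT : Fact (0 < T)] : C1 d T →ₗ[ℂ] FloquetSpace d T :=
  (ContinuousMap.toLp (E := Mat d) 2 (AddCircle.haarAddCircle (T := T)) ℂ).toLinearMap ∘ₗ derivC1

lemma derivToLp_apply {T : ℝ} [hT : Fact (0 < T)] (f : C1 d T) :
    derivToLp d T f = C0toLp d T (derivC1 f) := rfl

lemma derivOp_C1toLp {T : ℝ} [hT : Fact (0 < T)] (f : C1 d T)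
    (h : C1toLp d T f ∈ (derivOp d T).domain) :
    derivOp d T ⟨_, h⟩ = C0toLp d T (derivC1 f) := by
  have h1 : derivOp d T ⟨_, h⟩ = pmapOfInjective (V := C1 d T) (C1toLp d T) C1toLp_injective
    (derivToLp d T) ⟨C1toLp d T f, f, rfl⟩ := rfl
  have h2 := pmapOfInjective_apply (V := C1 d T) (C1toLp d T) C1toLp_injective (derivToLp d T) f
  exact h1.trans (h2.trans (derivToLp_apply f))

/-! ### The Floquet normal form of the generalized Lindbladian -/

namespace PeriodicSystem

variable {T : ℝ} {κ : Type*} [Fintype κ] (X : PeriodicSystem d T κ)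

/-- The derivative of `p`. -/
def pDeriv (t : ℝ) : Mat d := -(Complex.I • (X.H t * X.p t)) + Complex.I • (X.p t * X.Hbar)

lemma hasDerivAt_p (t : ℝ) : HasDerivAt X.p (X.pDeriv t) t :=
  hasDerivAt_mul_exp (X.u_deriv t) X.Hbar

lemma pDeriv_continuous : Continuous X.pDeriv := by
  have := X.p_continuous
  have := X.H_continuous
  unfold pDeriv
  fun_prop

lemma contDiff_of_hasDerivAt {f f' : ℝ → Mat d} (h : ∀ t, HasDerivAt f (f' t) t)
    (hc : Continuous f') : ContDiff ℝ 1 f := by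
  refine contDiff_one_iff_deriv.2 ⟨fun t => (h t).differentiableAt, ?_⟩
  rwa [show deriv f = f' from funext fun t => (h t).deriv]

/-- The equation `ṗ = -iHp + ipH̄` and its adjoint contribute on the two sides of `g`: the `H` terms
combine to a commutator outside `P`, the `H̄` terms to one inside. This is the intertwining relation
behind the normal form. -/
lemma hasDerivAt_P {g : ℝ → Mat d} {g' : Mat d} {t : ℝ} (hg : HasDerivAt g g' t) :
    HasDerivAt (fun s => X.P s (g s)) (-(Complex.I • adMap (X.H t) (X.P t (g t))) +
      X.P t (g' + Complex.I • adMap X.Hbar (g t))) t := by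
  have h := hasDerivAt_mul (X.hasDerivAt_p t)
    (hasDerivAt_mul hg (hasDerivAt_conjTranspose (X.hasDerivAt_p t)))
  refine h.congr_deriv ?_
  have hH : (X.H t)ᴴ = X.H t := X.H_hermitian t
  have hB : X.Hbarᴴ = X.Hbar := X.Hbar_hermitian
  simp only [pDeriv, P, adMap, sub_apply, mulLR_apply, mul_one, one_mul, Matrix.conjTranspose_add,
    Matrix.conjTranspose_neg, Matrix.conjTranspose_smul, Matrix.conjTranspose_mul, hH, hB,
    Complex.star_def, Complex.conj_I, mul_add, add_mul, mul_sub, sub_mul, mul_neg, neg_mul,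
    Matrix.mul_smul, Matrix.smul_mul, neg_smul, smul_sub, mul_assoc]
  abel

/-- Serves only to show that `P'` preserves `C¹`, so the derivative is left unsimplified; its
continuity is all that matters. -/
lemma hasDerivAt_Pinv {g : ℝ → Mat d} {g' : Mat d} {t : ℝ} (hg : HasDerivAt g g' t) :
    HasDerivAt (fun s => X.Pinv s (g s)) ((X.pDeriv t)ᴴ * (g t * X.p t) +
      (X.p t)ᴴ * (g' * X.p t + g t * X.pDeriv t)) t :=
  hasDerivAt_mul (hasDerivAt_conjTranspose (X.hasDerivAt_p t))
    (hasDerivAt_mul hg (X.hasDerivAt_p t))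

lemma Pcircle_Pdualcircle (t : AddCircle T) (a : Mat d) :
    X.Pcircle t (X.Pdualcircle t a) = a := by
  induction t using QuotientAddGroup.induction_on with
  | H t =>
    have h : X.P t (dualMap (X.P t) a) = a := by rw [dualMap_P, P_Pinv]
    exact h

variable [hT : Fact (0 < T)]

lemma applyCircle_Pcircle_mem_C1 (g : C1 d T) :
    applyCircle X.Pcircle (g : C(AddCircle T, Mat d)) ∈ C1 d T := by
  refine contDiff_of_hasDerivAt (fun t => X.hasDerivAt_P (hasDerivAt_C1 g t)) ?_
  have hmk : Continuous fun s : ℝ => (s : AddCircle T) := AddCircle.continuous_mk' T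
  have h1 : Continuous fun s : ℝ => (g : C(AddCircle T, Mat d)) (s : AddCircle T) :=
    (map_continuous _).comp hmk
  have h2 : Continuous fun s : ℝ => derivC1 g (s : AddCircle T) := (map_continuous _).comp hmk
  have := X.p_continuous
  have := X.H_continuous
  simp only [P, adMap, sub_apply, mulLR_apply]
  fun_prop

lemma applyCircle_Pdualcircle_mem_C1 (g : C1 d T) :
    applyCircle X.Pdualcircle (g : C(AddCircle T, Mat d)) ∈ C1 d T := by
  have e : (fun t : ℝ => applyCircle X.Pdualcircle (g : C(AddCircle T, Mat d)) (t : AddCircle T)) =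
      fun t : ℝ => X.Pinv t ((g : C(AddCircle T, Mat d)) (t : AddCircle T)) :=
    funext fun t => congrArg (fun A : Mat d →L[ℂ] Mat d => A _) (X.dualMap_P t)
  have h : ContDiff ℝ 1
      fun t : ℝ => X.Pinv t ((g : C(AddCircle T, Mat d)) (t : AddCircle T)) := by
    refine contDiff_of_hasDerivAt (fun t => X.hasDerivAt_Pinv (hasDerivAt_C1 g t)) ?_
    have hmk : Continuous fun s : ℝ => (s : AddCircle T) := AddCircle.continuous_mk' T
    have h1 : Continuous fun s : ℝ => (g : C(AddCircle T, Mat d)) (s : AddCircle T) :=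
      (map_continuous _).comp hmk
    have h2 : Continuous fun s : ℝ => derivC1 g (s : AddCircle T) := (map_continuous _).comp hmk
    have := X.p_continuous
    have := X.pDeriv_continuous
    fun_prop
  exact Eq.mpr (congrArg (ContDiff ℝ 1) e) h

/-- The function `P' f`. -/
def pullC1 (f : C1 d T) : C1 d T :=
  ⟨applyCircle X.Pdualcircle (f : C(AddCircle T, Mat d)), X.applyCircle_Pdualcircle_mem_C1 f⟩

/-- The Floquet normal form of the generalized Lindbladian, on `C¹` functions. -/
lemma Lcircle_sub_derivC1 (f : C1 d T) :
    applyCircle X.Lcircle (f : C(AddCircle T, Mat d)) - derivC1 f =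
      applyCircle X.Pcircle
        (applyCircle (ContinuousMap.const _ X.Lbar) (X.pullC1 f : C(AddCircle T, Mat d)) -
          derivC1 (X.pullC1 f)) := by
  ext1 t
  induction t using QuotientAddGroup.induction_on with
  | H t =>
    set g := X.pullC1 f with hg
    have hgt : (g : C(AddCircle T, Mat d)) (t : AddCircle T) =
        X.Pinv t ((f : C(AddCircle T, Mat d)) (t : AddCircle T)) :=
      congrArg (fun A : Mat d →L[ℂ] Mat d => A _) (X.dualMap_P t)
    have hfg : (fun s : ℝ => (f : C(AddCircle T, Mat d)) (s : AddCircle T)) =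
        fun s : ℝ => X.P s ((g : C(AddCircle T, Mat d)) (s : AddCircle T)) :=
      funext fun s => (X.Pcircle_Pdualcircle (s : AddCircle T) _).symm
    -- Since `f = P g`, this computes `f'` a second way. Its term `-i [H, f]` cancels the
    -- Hamiltonian part of `L f`, and what remains is `P` applied to `L̄ g - g'`.
    have h1 := X.hasDerivAt_P (hasDerivAt_C1 g t)
    rw [← hfg] at h1
    have h2 := (hasDerivAt_C1 f t).unique h1
    have h3 : X.L t ((f : C(AddCircle T, Mat d)) (t : AddCircle T)) - derivC1 f (t : AddCircle T) =
        X.P t (X.Lbar ((g : C(AddCircle T, Mat d)) (t : AddCircle T)) -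
          derivC1 g (t : AddCircle T)) := by
      rw [h2, hgt, P_Pinv]
      simp only [L, Lbar, add_apply, neg_apply, smul_apply, ContinuousLinearMap.comp_apply, map_add,
        map_sub, map_neg, map_smul]
      abel
    exact h3

lemma Ltilde_apply (f : C1 d T) : X.Ltilde ((iota (d := d) (T := T)).symm (C1toLp d T f)) =
    (iota (d := d) (T := T)).symm (C0toLp d T (applyCircle X.Lcircle (f : C(AddCircle T, Mat d)))) :=
  (lifting_iota_symm _ _).trans (congrArg _ (continuousOp_C0toLp X.Lcircle f))

lemma Pdualtilde_apply (f : C1 d T) :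
    X.Pdualtilde ((iota (d := d) (T := T)).symm (C1toLp d T f)) =
      (iota (d := d) (T := T)).symm (C1toLp d T (X.pullC1 f)) :=
  (lifting_iota_symm _ _).trans (congrArg _ (continuousOp_C0toLp X.Pdualcircle f))

/-- The converse holds because `P` also preserves `C¹` and undoes `P'` pointwise. Both directions
are needed: the product has as its domain the preimage of `ι⁻¹(C¹)` under `P̃'`. -/
lemma Pdualtilde_mem_tensorC1_iff (x : TensorSpace d T) :
    X.Pdualtilde x ∈ tensorC1 d T ↔ x ∈ tensorC1 d T := by
  constructor
  · intro h
    obtain ⟨g, hg⟩ := exists_of_mem_tensorC1 h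
    refine ⟨⟨_, X.applyCircle_Pcircle_mem_C1 g⟩, ?_⟩
    have h1 : continuousOp X.Pdualcircle (iota x) = C0toLp d T (g : C(AddCircle T, Mat d)) := by
      have := congrArg (iota (d := d) (T := T)) hg
      rw [Pdualtilde, iota_lifting, LinearIsometryEquiv.apply_symm_apply] at this
      exact this
    have h2 : continuousOp X.Pcircle (continuousOp X.Pdualcircle (iota x)) = iota x := by
      ext1
      filter_upwards [continuousOp_ae X.Pcircle (continuousOp X.Pdualcircle (iota x)),
        continuousOp_ae X.Pdualcircle (iota x)] with t h3 h4
      rw [h3, h4, Pcircle_Pdualcircle]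
    rw [h1, continuousOp_C0toLp] at h2
    exact h2
  · intro h
    obtain ⟨f, rfl⟩ := exists_of_mem_tensorC1 h
    rw [Pdualtilde_apply]
    exact mem_tensorC1 _

lemma genLindbladianTilde_domain : X.genLindbladianTilde.domain = tensorC1 d T := by
  have : X.genLindbladianTilde.domain =
      (⊤ ⊓ LinearMap.range (C1toLp d T)).comap (iota (d := d) (T := T)).toLinearEquiv.toLinearMap :=
    rfl
  rw [this, top_inf_eq]
  rfl

lemma genLindbladian_apply (f : C1 d T) (h : C1toLp d T f ∈ X.genLindbladian.domain) :
    X.genLindbladian ⟨_, h⟩ =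
      C0toLp d T (applyCircle X.Lcircle (f : C(AddCircle T, Mat d)) - derivC1 f) := by
  have h1 : X.genLindbladian ⟨_, h⟩ =
      continuousOp X.Lcircle (C1toLp d T f) - derivOp d T ⟨_, h.2⟩ := rfl
  rw [h1, derivOp_C1toLp, map_sub]
  exact congrArg (· - _) (continuousOp_C0toLp X.Lcircle f)

lemma genLindbladianTilde_apply (f : C1 d T)
    (h : (iota (d := d) (T := T)).symm (C1toLp d T f) ∈ X.genLindbladianTilde.domain) :
    X.genLindbladianTilde ⟨_, h⟩ = (iota (d := d) (T := T)).symm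
      (C0toLp d T (applyCircle X.Lcircle (f : C(AddCircle T, Mat d)) - derivC1 f)) := by
  have e := (iota (d := d) (T := T)).apply_symm_apply (C1toLp d T f)
  have hd : iota ((iota (d := d) (T := T)).symm (C1toLp d T f)) ∈ X.genLindbladian.domain := h
  have h1 : X.genLindbladianTilde ⟨_, h⟩ =
      (iota (d := d) (T := T)).symm (X.genLindbladian ⟨_, hd⟩) := rfl
  rw [h1, ← genLindbladian_apply X f (e ▸ hd)]
  congr 2
  exact Subtype.ext e

/-- Both operators have domain `ι⁻¹(C¹)`, and there `iΩ I ⊗ F_z` is the lifted derivative. -/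
theorem genLindbladianTilde_eq : X.genLindbladianTilde = X.Ltilde.toLinearMap.toPMap ⊤ -
    (Complex.I * (2 * Real.pi / T : ℝ)) • idTensorNumber d T := by
  refine pmap_ext_tensorC1 X.genLindbladianTilde_domain (toPMap_sub_idTensorNumber_domain _)
    fun f hA hB => ?_
  rw [genLindbladianTilde_apply, toPMap_sub_idTensorNumber_apply, map_sub, map_sub]
  exact congrArg (· - _) (X.Ltilde_apply f).symm

theorem genLindbladianTilde_eq_sandwich : X.genLindbladianTilde = sandwich X.Ptilde.toLinearMap
    ((TensorProduct.map X.Lbar.toLinearMap LinearMap.id).toPMap ⊤ -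
      (Complex.I * (2 * Real.pi / T : ℝ)) • idTensorNumber d T) X.Pdualtilde.toLinearMap := by
  refine pmap_ext_tensorC1 X.genLindbladianTilde_domain ?_ fun f hA hB => ?_
  · ext x
    have h : x ∈ (sandwich X.Ptilde.toLinearMap
        ((TensorProduct.map X.Lbar.toLinearMap LinearMap.id).toPMap ⊤ -
          (Complex.I * (2 * Real.pi / T : ℝ)) • idTensorNumber d T)
            X.Pdualtilde.toLinearMap).domain ↔ X.Pdualtilde x ∈
        ((TensorProduct.map X.Lbar.toLinearMap LinearMap.id).toPMap ⊤ -
          (Complex.I * (2 * Real.pi / T : ℝ)) • idTensorNumber d T).domain := Iff.rfl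
    rw [h, toPMap_sub_idTensorNumber_domain]
    exact X.Pdualtilde_mem_tensorC1_iff x
  · rw [genLindbladianTilde_apply, Lcircle_sub_derivC1]
    set A := (TensorProduct.map X.Lbar.toLinearMap
      (LinearMap.id : L2Circle T →ₗ[ℂ] L2Circle T)).toPMap ⊤ -
        (Complex.I * (2 * Real.pi / T : ℝ)) • idTensorNumber d T with hAdef
    -- The inner operator acts on `P' f`, which is again `C¹`; there its number term is the
    -- derivative, and the identity `Lcircle_sub_derivC1` applies.
    have hmem : (iota (d := d) (T := T)).symm (C1toLp d T (X.pullC1 f)) ∈ A.domain := by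
      rw [toPMap_sub_idTensorNumber_domain]; exact mem_tensorC1 _
    have h1 : A ⟨_, hmem⟩ = (iota (d := d) (T := T)).symm (C0toLp d T
        (applyCircle (ContinuousMap.const _ X.Lbar) (X.pullC1 f : C(AddCircle T, Mat d)) -
          derivC1 (X.pullC1 f))) := by
      rw [toPMap_sub_idTensorNumber_apply, map_sub, map_sub]
      congr 1
      apply (iota (d := d) (T := T)).injective
      rw [iota_map_id, LinearIsometryEquiv.apply_symm_apply, LinearIsometryEquiv.apply_symm_apply]
      exact continuousOp_C0toLp _ _
    have h2 : sandwich X.Ptilde.toLinearMap A X.Pdualtilde.toLinearMap ⟨_, hB⟩ =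
        X.Ptilde (A ⟨_, hmem⟩) :=
      congrArg (fun y => X.Ptilde (A y)) (Subtype.ext (X.Pdualtilde_apply f))
    rw [h2, h1, Ptilde, lifting_iota_symm, continuousOp_C0toLp]

end PeriodicSystem

end FloquetLindblad

end

/-! ### The main theorem -/

open FloquetLindblad
theorem mainTheorem5 (d : ℕ) (hd : 1 ≤ d) (T : ℝ) [hT : Fact (0 < T)] {κ : Type*} [Fintype κ]
    (X : PeriodicSystem d T κ) :
    (∀ x ∈ tensorC0 d T, HasSum
      (fun n : ℤ => TensorProduct.map (fourierCoeff X.Lcircle n).toLinearMap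
        (fourierShift T n).toLinearMap x) (X.Ltilde x)) ∧
    (X.genLindbladianTilde = X.Ltilde.toLinearMap.toPMap ⊤ -
        (Complex.I * (2 * Real.pi / T : ℝ)) • idTensorNumber d T ∧
      X.genLindbladianTilde = sandwich X.Ptilde.toLinearMap
        ((TensorProduct.map X.Lbar.toLinearMap LinearMap.id).toPMap ⊤ -
          (Complex.I * (2 * Real.pi / T : ℝ)) • idTensorNumber d T) X.Pdualtilde.toLinearMap) ∧
    IsStandardForm X.Ltilde :=
  ⟨fun _ hx => hasSum_map_fourierShift X.Lcircle hx,
    ⟨X.genLindbladianTilde_eq, X.genLindbladianTilde_eq_sandwich⟩, X.isStandardForm_Ltilde hd⟩
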